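/- For a continuous map $f\colon X\to Y$ of simply connected spaces consider the induced $\mathbb Q$-linear maps $H_i(f;\mathbb Q)\colon H_i(X;\mathbb Q)\to H_i(Y;\mathbb Q)$ ($i\ge 0$, singular homology) and $\pi_i(f)\otimes\mathbb Q\colon \pi_i(X)\otimes\mathbb Q\to\pi_i(Y)\otimes\mathbb Q$ ($i\ge 2$; homotopy groups are taken at a base point $x\in X$ and at $f(x)\in Y$). The map $f$ is called rationally elliptic with respect to kernel if $\sum_i\dim\operatorname{Ker}H_i(f;\mathbb Q)<\infty$ and $\sum_{i\ge 2}\dim\operatorname{Ker}(\pi_i(f)\otimes\mathbb Q)<\infty$. For such $f$ put $$P_f(t)=1+\sum_{i\ge 2}\dim\bigl(\operatorname{Ker}H_i(f;\mathbb Q)\bigr)\,t^i,\qquad P^\pi_f(t)=\sum_{i\ge 2}\dim\bigl(\operatorname{Ker}(\pi_i(f)\otimes\mathbb Q)\bigr)\,t^i .$$ Let $f_1\colon X_1\to Y_1$ and $f_2\colon X_2\to Y_2$ be continuous maps of simply connected spaces that are rationally elliptic with respect to kernel, and assume that $X_1$ and $X_2$ have finite homology rank, i.e. $\sum_i\dim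 H_i(X_j;\mathbb Q)<\infty$ for $j=1,2$. Suppose that the relative Hilali inequality $P^\pi_{f_j}(1)\le P_{f_j}(1)$ holds for $j=1,2$, and that one of the following holds: 1. $P_{f_1}(1)\ge 2$ and $P_{f_2}(1)\ge 2$; 2. $P^\pi_{f_1}(1)=0$ or $P^\pi_{f_2}(1)=0$. Then $f_1\times f_2\colon X_1\times X_2\to Y_1\times Y_2$ is rationally elliptic with respect to kernel, so that its Poincaré polynomials are defined, and $$P^\pi_{f_1\times f_2}(1)\le P_{f_1\times f_2}(1).$$ That is, in these two cases the relative Hilali inequality for $f_1$ and $f_2$ implies the one for the product $f_1\times f_2$. -/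

import Mathlib

open CategoryTheory AlgebraicTopology
open scoped Topology Polynomial TensorProduct

universe u

namespace RatMap

section Homology

/-- Singular homology `H_i(X; ℚ)`. -/
noncomputable abbrev homology (i : ℕ) (X : Type u) [TopologicalSpace X] : ModuleCat.{u} ℚ :=
  ((singularHomologyFunctor (ModuleCat.{u} ℚ) i).obj (ModuleCat.of ℚ (ULift.{u} ℚ))).obj
    (TopCat.of X)

variable {X Y : Type u} [TopologicalSpace X] [TopologicalSpace Y]

/-- The linear map `H_i(f; ℚ) : H_i(X; ℚ) → H_i(Y; ℚ)` induced by `f`. -/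
noncomputable def homologyMap (i : ℕ) (f : C(X, Y)) : homology i X →ₗ[ℚ] homology i Y :=
  (((singularHomologyFunctor (ModuleCat.{u} ℚ) i).obj (ModuleCat.of ℚ (ULift.{u} ℚ))).map
    (TopCat.ofHom f)).hom

end Homology

section Homotopy

variable {X Y : Type u} [TopologicalSpace X] [TopologicalSpace Y]

/-- Composition of a generalized loop with a continuous map. -/
def genLoopMap {N : Type*} (f : C(X, Y)) (x : X) (p : GenLoop N X x) : GenLoop N Y (f x) :=
  ⟨f.comp p.1, fun y hy => congrArg f (p.2 y hy)⟩

/-- The map of homotopy classes `[p] ↦ [f ∘ p]`. -/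
def homotopyGroupMapFun {N : Type*} (f : C(X, Y)) (x : X) :
    HomotopyGroup N X x → HomotopyGroup N Y (f x) :=
  Quotient.map (genLoopMap f x) fun _ _ h => h.comp_continuousMap f

theorem homotopyGroupMapFun_mul {n : ℕ} (f : C(X, Y)) (x : X) (a b : π_ (n + 2) X x) :
    homotopyGroupMapFun f x (a * b) = homotopyGroupMapFun f x a * homotopyGroupMapFun f x b := by
  induction a using Quotient.inductionOn with | _ p
  induction b using Quotient.inductionOn with | _ q
  have h1 := HomotopyGroup.mul_spec (i := (0 : Fin (n + 2))) (p := p) (q := q)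
  have h2 := HomotopyGroup.mul_spec (i := (0 : Fin (n + 2)))
    (p := genLoopMap f x p) (q := genLoopMap f x q)
  refine (congrArg (homotopyGroupMapFun f x) h1).trans (Eq.trans ?_ h2.symm)
  refine congrArg (Quotient.mk _) ?_
  ext t
  exact apply_ite f _ _ _

/-- The homomorphism `π_{n+2}(f) : π_{n+2}(X, x) → π_{n+2}(Y, f x)` of (additively written)
abelian groups. -/
noncomputable def homotopyGroupMap (n : ℕ) (f : C(X, Y)) (x : X) :
    Additive (π_ (n + 2) X x) →+ Additive (π_ (n + 2) Y (f x)) :=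
  MonoidHom.toAdditive (MonoidHom.mk' (homotopyGroupMapFun f x) (homotopyGroupMapFun_mul f x))

/-- The `ℚ`-linear map `π_{n+2}(f) ⊗ ℚ`. -/
noncomputable def rationalHomotopyMap (n : ℕ) (f : C(X, Y)) (x : X) :
    ℚ ⊗[ℤ] Additive (π_ (n + 2) X x) →ₗ[ℚ] ℚ ⊗[ℤ] Additive (π_ (n + 2) Y (f x)) :=
  (homotopyGroupMap n f x).toIntLinearMap.baseChange ℚ

end Homotopy

/-- The graded vector space `V` has finite total dimension, `∑ i, dim V i < ∞`: each `V i` is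
finite dimensional and only finitely many are nonzero. -/
def FiniteTotalDim (V : ℕ → Type*) [∀ i, AddCommGroup (V i)] [∀ i, Module ℚ (V i)] : Prop :=
  (∀ i, FiniteDimensional ℚ (V i)) ∧ {i | Nontrivial (V i)}.Finite

/-- `X` has finite homology rank, `dim H_*(X; ℚ) < ∞`. -/
def FiniteHomologyRank (X : Type u) [TopologicalSpace X] : Prop :=
  FiniteTotalDim fun i => homology i X

variable {X Y : Type u} [TopologicalSpace X] [TopologicalSpace Y]

/-- `f` is rationally elliptic with respect to kernel: `dim Ker H_*(f; ℚ) < ∞` and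
`dim Ker (π_*(f) ⊗ ℚ) < ∞`. The homotopy groups are those in degrees `n + 2`, based at `x`. -/
structure IsRationallyEllipticKer (f : C(X, Y)) (x : X) : Prop where
  homology : FiniteTotalDim fun i => LinearMap.ker (homologyMap i f)
  homotopy : FiniteTotalDim fun n => LinearMap.ker (rationalHomotopyMap n f x)

/-- The homological Poincaré polynomial
`P_f(t) = 1 + ∑_{i ≥ 2} dim (Ker H_i(f; ℚ)) t ^ i` (the index is `i = n + 2`). -/
noncomputable def homologicalPoincare (f : C(X, Y)) : ℕ[X] :=
  1 + ∑ᶠ n : ℕ, Polynomial.monomial (n + 2)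
    (Module.finrank ℚ (LinearMap.ker (homologyMap (n + 2) f)))

/-- The homotopical Poincaré polynomial
`P^π_f(t) = ∑_{i ≥ 2} dim (Ker (π_i(f) ⊗ ℚ)) t ^ i` (the index is `i = n + 2`). -/
noncomputable def homotopicalPoincare (f : C(X, Y)) (x : X) : ℕ[X] :=
  ∑ᶠ n : ℕ, Polynomial.monomial (n + 2)
    (Module.finrank ℚ (LinearMap.ker (rationalHomotopyMap n f x)))

end RatMap

namespace RatMap

open Limits Simplicial Opposite

/-- Simplicial rational vector spaces. -/
abbrev SMod : Type (u + 1) := SimplicialObject (ModuleCat.{u} ℚ)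

/-- The bifunctor `(S, M) ↦ S →₀ M`. -/
noncomputable def finsuppFunctor : Type u ⥤ ModuleCat.{u} ℚ ⥤ ModuleCat.{u} ℚ where
  obj S :=
    { obj M := ModuleCat.of ℚ (S →₀ M)
      map f := ModuleCat.ofHom (Finsupp.mapRange.linearMap f.hom)
      map_id M := by ext; simp
      map_comp f g := by ext; simp }
  map g :=
    { app M := ModuleCat.ofHom (Finsupp.lmapDomain M ℚ g)
      naturality M N f := by
        ext : 1
        refine Finsupp.lhom_ext fun s m => ?_
        simp [Finsupp.mapDomain_single] }
  map_id S := by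
    ext M : 3
    exact Finsupp.lmapDomain_id M ℚ
  map_comp f g := by
    ext M : 3
    exact Finsupp.lmapDomain_comp M ℚ f g

/-- The degreewise tensor product of a simplicial vector space with the free simplicial vector
space on a simplicial set. -/
noncomputable def tensor : SSet.{u} ⥤ SMod.{u} ⥤ SMod.{u} where
  obj T :=
    { obj A := Functor.prod' T A ⋙ Functor.uncurry.obj finsuppFunctor
      map f := Functor.whiskerRight (NatTrans.prod' (𝟙 T) f) _
      map_id A := Functor.whiskerRight_id' (Functor.uncurry.obj finsuppFunctor)
      map_comp f g := by
        rw [← Functor.whiskerRight_comp]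
        congr 1 }
  map {T T'} φ :=
    { app A := Functor.whiskerRight (NatTrans.prod' φ (𝟙 A)) _
      naturality A B f := by
        dsimp only
        rw [← Functor.whiskerRight_comp, ← Functor.whiskerRight_comp]
        congr 1 }
  map_id T := by
    ext A : 2
    exact Functor.whiskerRight_id' (Functor.uncurry.obj finsuppFunctor)
  map_comp φ ψ := by
    ext A : 2
    refine Eq.trans ?_ (Functor.whiskerRight_comp _ _ _)
    dsimp only
    congr 1

lemma tensor_map_single {T : SSet.{u}} {A : SMod.{u}} {m n : SimplexCategoryᵒᵖ} (θ : m ⟶ n)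
    (t : T.obj m) (a : A.obj m) :
    (((tensor.obj T).obj A).map θ).hom (Finsupp.single t a) =
      Finsupp.single (T.map θ t) ((A.map θ).hom a) :=
  (congrArg (Finsupp.mapRange.linearMap (A.map θ).hom)
    (Finsupp.mapDomain_single (f := T.map θ) (a := t) (b := a))).trans
    (Finsupp.mapRange_single (hf := map_zero _))

lemma tensor_map_app {T : SSet.{u}} {A B : SMod.{u}} (f : A ⟶ B) (n : SimplexCategoryᵒᵖ) :
    ((tensor.obj T).map f).app n = (finsuppFunctor.obj (T.obj n)).map (f.app n) := by
  change (finsuppFunctor.map (𝟙 _)).app _ ≫ _ = _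
  simp

lemma tensor_map_app_app {T T' : SSet.{u}} (φ : T ⟶ T') (A : SMod.{u}) (n : SimplexCategoryᵒᵖ) :
    ((tensor.map φ).app A).app n = (finsuppFunctor.map (φ.app n)).app (A.obj n) := by
  change _ ≫ (finsuppFunctor.obj _).map (𝟙 _) = _
  simp

lemma tensor_map_app_single {T : SSet.{u}} {A B : SMod.{u}} (f : A ⟶ B)
    {n : SimplexCategoryᵒᵖ} (t : T.obj n) (a : A.obj n) :
    (((tensor.obj T).map f).app n).hom (Finsupp.single t a) =
      Finsupp.single t ((f.app n).hom a) := by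
  rw [tensor_map_app]
  exact Finsupp.mapRange_single (hf := map_zero _)

lemma tensor_map_app_app_single {T T' : SSet.{u}} (φ : T ⟶ T') (A : SMod.{u})
    {n : SimplexCategoryᵒᵖ} (t : T.obj n) (a : A.obj n) :
    (((tensor.map φ).app A).app n).hom (Finsupp.single t a) =
      Finsupp.single (φ.app n t) a := by
  rw [tensor_map_app_app]
  exact Finsupp.mapDomain_single

/-- Morphisms out of a component of `tensor T A` are determined on basis elements. -/
lemma tensor_hom_ext {T : SSet.{u}} {A : SMod.{u}} {n : SimplexCategoryᵒᵖ} {M : ModuleCat.{u} ℚ}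
    {f g : ((tensor.obj T).obj A).obj n ⟶ M}
    (h : ∀ (t : T.obj n) (a : A.obj n), f.hom (Finsupp.single t a) = g.hom (Finsupp.single t a)) :
    f = g :=
  ModuleCat.hom_ext (Finsupp.lhom_ext h)

/-- Chains of `tensor T A`. -/
noncomputable def chains (T : SSet.{u}) : SMod.{u} ⥤ ChainComplex (ModuleCat.{u} ℚ) ℕ :=
  tensor.obj T ⋙ alternatingFaceMapComplex _

/-- Homology of `tensor T A`. -/
noncomputable def HH (k : ℕ) (T : SSet.{u}) : SMod.{u} ⥤ ModuleCat.{u} ℚ :=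
  chains T ⋙ HomologicalComplex.homologyFunctor _ _ k

instance (T : SSet.{u}) : (tensor.obj T).Additive where
  map_add {A B f g} := by
    refine SimplicialObject.hom_ext _ _ fun n => ?_
    refine tensor_hom_ext fun t a => ?_
    refine (tensor_map_app_single _ _ _).trans ?_
    refine Eq.trans (Finsupp.single_add t ((f.app n).hom a) ((g.app n).hom a)) ?_
    exact (congrArg₂ (· + ·) (tensor_map_app_single f t a) (tensor_map_app_single g t a)).symm

instance (T : SSet.{u}) : (chains T).Additive := by unfold chains; infer_instance
instance (k : ℕ) (T : SSet.{u}) : (HH k T).Additive := by unfold HH; infer_instance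

/-- The change of simplicial set in the homology of `tensor T A`. -/
noncomputable def HHmap (k : ℕ) {T T' : SSet.{u}} (φ : T ⟶ T') : HH k T ⟶ HH k T' :=
  Functor.whiskerRight (Functor.whiskerRight (tensor.map φ) _) _

/-- Simplicially homotopic maps agree in the homology of `tensor T`. -/
lemma HH_map_eq_of_homotopy (k : ℕ) (T : SSet.{u}) {A B : SMod.{u}} {f g : A ⟶ B}
    (h : SimplicialObject.Homotopy f g) : (HH k T).map f = (HH k T).map g := by
  let h' : SimplicialObject.Homotopy (NatTrans.prod' (𝟙 T) f) (NatTrans.prod' (𝟙 T) g) :=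
    let h₀ := SimplicialObject.Homotopy.refl (𝟙 T)
    { h i := (h₀.h i, h.h i)
      h_zero_comp_δ_zero n := Prod.ext (h₀.h_zero_comp_δ_zero n) (h.h_zero_comp_δ_zero n)
      h_last_comp_δ_last n := Prod.ext (h₀.h_last_comp_δ_last n) (h.h_last_comp_δ_last n)
      h_succ_comp_δ_castSucc_of_lt i j hij :=
        Prod.ext (h₀.h_succ_comp_δ_castSucc_of_lt i j hij) (h.h_succ_comp_δ_castSucc_of_lt i j hij)
      h_succ_comp_δ_castSucc_succ j :=
        Prod.ext (h₀.h_succ_comp_δ_castSucc_succ j) (h.h_succ_comp_δ_castSucc_succ j)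
      h_castSucc_comp_δ_succ_of_lt i j hij :=
        Prod.ext (h₀.h_castSucc_comp_δ_succ_of_lt i j hij) (h.h_castSucc_comp_δ_succ_of_lt i j hij)
      h_comp_σ_castSucc_of_le i j hij :=
        Prod.ext (h₀.h_comp_σ_castSucc_of_le i j hij) (h.h_comp_σ_castSucc_of_le i j hij)
      h_comp_σ_succ_of_lt i j hij :=
        Prod.ext (h₀.h_comp_σ_succ_of_lt i j hij) (h.h_comp_σ_succ_of_lt i j hij) }
  exact (h'.whiskerRight (Functor.uncurry.obj finsuppFunctor)).map_homology_eq k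

lemma finsupp_mapRange_exact {S M N P : Type*} [AddCommGroup M] [AddCommGroup N] [AddCommGroup P]
    [Module ℚ M] [Module ℚ N] [Module ℚ P] {f : M →ₗ[ℚ] N} {g : N →ₗ[ℚ] P}
    (hf : Function.Injective f) (h : Function.Exact f g) :
    Function.Exact (Finsupp.mapRange.linearMap (α := S) f)
      (Finsupp.mapRange.linearMap (α := S) g) := by
  intro y
  constructor
  · intro hy
    have hy' : ∀ t, ∃ x, f x = y t := fun t => (h _).1 (DFunLike.congr_fun hy t)
    choose x hxy using hy'
    refine ⟨Finsupp.onFinset y.support x fun t ht => ?_, Finsupp.ext hxy⟩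
    rw [Finsupp.mem_support_iff, ← hxy]
    exact fun h0 => ht (hf (h0.trans (map_zero _).symm))
  · rintro ⟨x, rfl⟩
    exact Finsupp.ext fun t => h.apply_apply_eq_zero (x t)

lemma tensor_shortExact_app (T : SSet.{u}) {S : ShortComplex SMod.{u}} (hS : S.ShortExact)
    (n : SimplexCategoryᵒᵖ) :
    Function.Injective (((tensor.obj T).map S.f).app n).hom ∧
      Function.Exact (((tensor.obj T).map S.f).app n).hom (((tensor.obj T).map S.g).app n).hom ∧
      Function.Surjective (((tensor.obj T).map S.g).app n).hom := by
  have hm := hS.mono_f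
  have he := hS.epi_g
  have h := hS.map ((evaluation _ _).obj n)
  have hf : Function.Injective (S.f.app n).hom := (ModuleCat.mono_iff_injective _).1 h.mono_f
  have hg : Function.Surjective (S.g.app n).hom := (ModuleCat.epi_iff_surjective _).1 h.epi_g
  have hx : Function.Exact (S.f.app n).hom (S.g.app n).hom :=
    (ShortComplex.ShortExact.moduleCat_exact_iff_function_exact _).1 h.exact
  rw [tensor_map_app, tensor_map_app]
  exact ⟨Finsupp.mapRange_injective _ (map_zero _) hf, finsupp_mapRange_exact hf hx,
    Finsupp.mapRange_surjective _ (map_zero _) hg⟩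

/-- Tensoring preserves short exact sequences. -/
lemma chains_shortExact (T : SSet.{u}) {S : ShortComplex SMod.{u}} (hS : S.ShortExact) :
    (S.map (chains T)).ShortExact := by
  refine HomologicalComplex.shortExact_of_degreewise_shortExact _ fun i => ?_
  have h := tensor_shortExact_app T hS (op ⦋i⦌)
  exact
    { exact := (ShortComplex.ShortExact.moduleCat_exact_iff_function_exact _).2 h.2.1
      mono_f := (ModuleCat.mono_iff_injective _).2 h.1
      epi_g := (ModuleCat.epi_iff_surjective _).2 h.2.2 }

/-- The functor `[n] ↦ [n + 1]` adjoining a new initial vertex. -/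
def shift : SimplexCategory ⥤ SimplexCategory where
  obj n := ⦋n.len + 1⦌
  map f := SimplexCategory.Hom.mk
    { toFun i := Fin.cases 0 (fun j => (f.toOrderHom j).succ) i
      monotone' := by
        intro i j hij
        induction i using Fin.cases with
        | zero => exact Fin.zero_le _
        | succ i =>
          induction j using Fin.cases with
          | zero => simp at hij
          | succ j => simpa using f.toOrderHom.monotone (by simpa using hij) }
  map_id n := by
    ext i : 3
    induction i using Fin.cases <;> rfl
  map_comp f g := by
    ext i : 3
    induction i using Fin.cases <;> rfl

/-- The inclusion of the vertices other than the new one. -/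
def shiftCoface : 𝟭 _ ⟶ shift where
  app n := SimplexCategory.Hom.mk (Fin.succOrderEmb (n.len + 1)).toOrderHom
  naturality m n f := by
    ext i : 3
    rfl

lemma shift_map_δ {n : ℕ} (i : Fin (n + 2)) :
    shift.map (SimplexCategory.δ i) = SimplexCategory.δ i.succ := by
  ext j : 3
  induction j using Fin.cases with
  | zero => exact (Fin.succ_succAbove_zero i).symm
  | succ j => exact (Fin.succ_succAbove_succ i j).symm

lemma shift_map_σ {n : ℕ} (i : Fin (n + 1)) :
    shift.map (SimplexCategory.σ i) = SimplexCategory.σ i.succ := by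
  ext j : 3
  induction j using Fin.cases with
  | zero => rfl
  | succ j => exact (Fin.succ_predAbove_succ i j).symm

/-- The constant simplicial vector space. -/
abbrev constS : ModuleCat.{u} ℚ ⥤ SMod.{u} := SimplicialObject.const _

/-- The décalage of a simplicial vector space. -/
def dec (A : SMod.{u}) : SMod.{u} := shift.op ⋙ A

/-- Functoriality of the décalage. -/
def decMap {A B : SMod.{u}} (f : A ⟶ B) : dec A ⟶ dec B := Functor.whiskerLeft shift.op f

/-- The projection of the décalage forgetting the new vertex. -/
def decFace (A : SMod.{u}) : dec A ⟶ A := Functor.whiskerRight (NatTrans.op shiftCoface) A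

/-- The projection of the décalage to the new vertex. -/
def decVertex (A : SMod.{u}) : dec A ⟶ constS.obj (A _⦋0⦌) :=
  { app n := A.map (SimplexCategory.const ⦋0⦌ ⦋n.unop.len + 1⦌ 0).op
    naturality m n f := by
      refine (A.map_comp _ _).symm.trans (Eq.trans ?_ (Category.comp_id _).symm)
      exact congrArg (fun g => A.map (Quiver.Hom.op g)) (by ext i : 3; rfl) }

lemma decMap_decFace {A B : SMod.{u}} (f : A ⟶ B) : decMap f ≫ decFace B = decFace A ≫ f := by
  refine SimplicialObject.hom_ext _ _ fun n => ?_
  exact (f.naturality _).symm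

lemma decMap_decVertex {A B : SMod.{u}} (f : A ⟶ B) :
    decMap f ≫ decVertex B = decVertex A ≫ constS.map (f.app _) := by
  refine SimplicialObject.hom_ext _ _ fun n => ?_
  exact (f.naturality _).symm

lemma dec_δ (A : SMod.{u}) {n : ℕ} (i : Fin (n + 2)) : (dec A).δ i = A.δ i.succ :=
  congrArg (fun g => A.map (Quiver.Hom.op g)) (shift_map_δ i)

lemma dec_σ (A : SMod.{u}) {n : ℕ} (i : Fin (n + 1)) : (dec A).σ i = A.σ i.succ :=
  congrArg (fun g => A.map (Quiver.Hom.op g)) (shift_map_σ i)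

/-- The extra degeneracy of the décalage. -/
def decExtraDegeneracy (A : SMod.{u}) :
    SimplicialObject.Augmented.ExtraDegeneracy
      ({ left := dec A, right := A _⦋0⦌, hom := decVertex A } : SimplicialObject.Augmented _) where
  s' := A.σ 0
  s n := A.σ 0
  s'_comp_ε := by
    refine (A.map_comp _ _).symm.trans (Eq.trans ?_ (A.map_id _))
    exact congrArg (fun g => A.map (Quiver.Hom.op g)) (by ext i : 3; exact Subsingleton.elim (α := Fin 1) _ _)
  s₀_comp_δ₁ := by
    refine (congrArg (A.σ 0 ≫ ·) (dec_δ A 1)).trans ?_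
    refine (A.map_comp _ _).symm.trans (Eq.trans ?_ (A.map_comp _ _))
    exact congrArg (fun g => A.map (Quiver.Hom.op g)) (by ext i : 3; fin_cases i <;> rfl)
  s_comp_δ₀ n := (congrArg (A.σ 0 ≫ ·) (dec_δ A 0)).trans (A.δ_comp_σ_succ (i := 0))
  s_comp_δ n i := by
    refine (congrArg (A.σ 0 ≫ ·) (dec_δ A i.succ)).trans ?_
    refine Eq.trans ?_ (congrArg (· ≫ A.σ 0) (dec_δ A i)).symm
    exact A.δ_comp_σ_of_gt (i := i.succ) (j := 0) (Fin.succ_pos i)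
  s_comp_σ n i := by
    refine (congrArg (A.σ 0 ≫ ·) (dec_σ A i.succ)).trans ?_
    refine Eq.trans ?_ (congrArg (· ≫ A.σ 0) (dec_σ A i)).symm
    exact (A.σ_comp_σ (i := 0) (j := i.succ) (Fin.zero_le _)).symm

instance (k : ℕ) (T : SSet.{u}) (A : SMod.{u}) : IsIso ((HH k T).map (decVertex A)) := by
  let e := decExtraDegeneracy A
  have h1 : e.section_ ≫ decVertex A = 𝟙 _ := e.section_comp_hom
  have h2 := HH_map_eq_of_homotopy k T e.homotopy
  refine ⟨(HH k T).map e.section_, ?_, ?_⟩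
  · rw [← Functor.map_comp]
    exact h2.trans (CategoryTheory.Functor.map_id _ _)
  · rw [← Functor.map_comp, h1, CategoryTheory.Functor.map_id]

instance (A : SMod.{u}) : Epi (decVertex A) :=
  epi_of_epi_fac (decExtraDegeneracy A).section_comp_hom

/-- The connecting homomorphism in the homology of `tensor T`. -/
noncomputable def HHδ (k : ℕ) (T : SSet.{u}) {S : ShortComplex SMod.{u}} (hS : S.ShortExact) :
    (HH (k + 1) T).obj S.X₃ ⟶ (HH k T).obj S.X₁ :=
  (chains_shortExact T hS).δ (k + 1) k rfl

variable (k : ℕ) (T : SSet.{u}) {S : ShortComplex SMod.{u}} (hS : S.ShortExact)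

include hS in
lemma HH_exact₂ : Function.Exact ((HH k T).map S.f).hom ((HH k T).map S.g).hom :=
  (ShortComplex.ShortExact.moduleCat_exact_iff_function_exact _).1
    ((chains_shortExact T hS).homology_exact₂ k)

lemma HH_exact₃ : Function.Exact ((HH (k + 1) T).map S.g).hom (HHδ k T hS).hom :=
  (ShortComplex.ShortExact.moduleCat_exact_iff_function_exact _).1
    ((chains_shortExact T hS).homology_exact₃ (k + 1) k rfl)

lemma HH_exact₁ : Function.Exact (HHδ k T hS).hom ((HH k T).map S.f).hom :=
  (ShortComplex.ShortExact.moduleCat_exact_iff_function_exact _).1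
    ((chains_shortExact T hS).homology_exact₁ (k + 1) k rfl)

include hS in
lemma HH_zero_surjective : Function.Surjective ((HH 0 T).map S.g).hom := by
  rw [← ModuleCat.epi_iff_surjective]
  have h := chains_shortExact T hS
  have he := h.epi_g
  have : Epi (HomologicalComplex.cyclesMap (S.map (chains T)).g 0 ≫
      ((S.map (chains T)).X₃).homologyπ 0) := by
    have h1 : ∀ K : ChainComplex (ModuleCat.{u} ℚ) ℕ, IsIso (K.iCycles 0) := fun K =>
      K.isIso_iCycles 0 _ rfl (K.shape _ _ (by simp))
    have : Epi (HomologicalComplex.cyclesMap (S.map (chains T)).g 0 ≫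
        ((S.map (chains T)).X₃).iCycles 0) := by
      rw [HomologicalComplex.cyclesMap_i]
      infer_instance
    have : Epi (HomologicalComplex.cyclesMap (S.map (chains T)).g 0) := by
      have := epi_comp (HomologicalComplex.cyclesMap (S.map (chains T)).g 0 ≫
        ((S.map (chains T)).X₃).iCycles 0) (inv (((S.map (chains T)).X₃).iCycles 0))
      simpa using this
    infer_instance
  rw [← HomologicalComplex.homologyπ_naturality] at this
  exact @epi_of_epi _ _ _ _ _ _ _ this

lemma HHδ_naturality {S' : ShortComplex SMod.{u}} (hS' : S'.ShortExact) (φ : S ⟶ S') :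
    HHδ k T hS ≫ (HH k T).map φ.τ₁ = (HH (k + 1) T).map φ.τ₃ ≫ HHδ k T hS' :=
  HomologicalComplex.HomologySequence.δ_naturality ((chains T).mapShortComplex.map φ)
    (chains_shortExact T hS) (chains_shortExact T hS') (k + 1) k rfl

lemma HHδ_naturality_left {T' : SSet.{u}} (ψ : T ⟶ T') :
    HHδ k T hS ≫ (HHmap k ψ).app S.X₁ = (HHmap (k + 1) ψ).app S.X₃ ≫ HHδ k T' hS :=
  HomologicalComplex.HomologySequence.δ_naturality
    (S.mapNatTrans (Functor.whiskerRight (tensor.map ψ) (alternatingFaceMapComplex _)))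
    (chains_shortExact T hS) (chains_shortExact T' hS) (k + 1) k rfl

variable (A B : SMod.{u}) (f : A ⟶ B)

/-- The path object: simplices whose first vertex is zero. -/
noncomputable abbrev pathObj : SMod.{u} := kernel (decVertex A)

/-- The end point projection of the path object. -/
noncomputable abbrev pathEnd : pathObj A ⟶ A := kernel.ι (decVertex A) ≫ decFace A

/-- The simplicial vector space of components, as a quotient of `A`. -/
noncomputable abbrev compObj : SMod.{u} := cokernel (pathEnd A)

/-- The kernel of the projection to the components. -/
noncomputable abbrev redObj : SMod.{u} := Abelian.image (pathEnd A)

/-- The loop object. -/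
noncomputable abbrev loopObj : SMod.{u} := kernel (pathEnd A)

variable {A B}

/-- Functoriality of the path object. -/
noncomputable def pathMap : pathObj A ⟶ pathObj B :=
  kernel.map _ _ (decMap f) (constS.map (f.app _)) (decMap_decVertex f).symm

lemma pathMap_pathEnd : pathMap f ≫ pathEnd B = pathEnd A ≫ f := by
  simp [pathMap, decMap_decFace]

/-- Functoriality of `compObj`. -/
noncomputable def compMap : compObj A ⟶ compObj B :=
  cokernel.map _ _ (pathMap f) f (pathMap_pathEnd f).symm

/-- Functoriality of `redObj`. -/
noncomputable def redMap : redObj A ⟶ redObj B :=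
  kernel.map _ _ f (compMap f) (by simp [compMap])

/-- Functoriality of the loop object. -/
noncomputable def loopMap : loopObj A ⟶ loopObj B :=
  kernel.map _ _ (pathMap f) f (pathMap_pathEnd f).symm

variable (A)

lemma kernel_ι_factorThruImage :
    kernel.ι (pathEnd A) ≫ Abelian.factorThruImage (pathEnd A) = 0 := by
  rw [← cancel_mono (Abelian.image.ι (pathEnd A)), Category.assoc, Abelian.image.fac,
    kernel.condition, zero_comp]

/-- The path fibration. -/
noncomputable def pathSeq : ShortComplex SMod.{u} :=
  ShortComplex.mk (kernel.ι (pathEnd A)) (Abelian.factorThruImage (pathEnd A))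
    (kernel_ι_factorThruImage A)

/-- The decomposition into components. -/
noncomputable def compSeq : ShortComplex SMod.{u} :=
  ShortComplex.mk (Abelian.image.ι (pathEnd A)) (cokernel.π (pathEnd A)) (by simp)

lemma pathSeq_shortExact : (pathSeq A).ShortExact where
  mono_f := by dsimp [pathSeq]; infer_instance
  epi_g := by dsimp [pathSeq]; infer_instance
  exact := ShortComplex.exact_of_f_is_kernel _
    (isKernelOfComp (f := Abelian.factorThruImage (pathEnd A)) (Abelian.image.ι (pathEnd A)) _
      (kernelIsKernel (pathEnd A)) (kernel_ι_factorThruImage A)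
      (Abelian.image.fac (pathEnd A)))

lemma compSeq_shortExact : (compSeq A).ShortExact where
  mono_f := by dsimp [compSeq]; infer_instance
  epi_g := by dsimp [compSeq]; infer_instance
  exact := ShortComplex.exact_of_f_is_kernel _ (kernelIsKernel _)

variable {A}

lemma pathMap_factorThruImage :
    pathMap f ≫ Abelian.factorThruImage (pathEnd B) =
      Abelian.factorThruImage (pathEnd A) ≫ redMap f := by
  have h : redMap f ≫ Abelian.image.ι (pathEnd B) = Abelian.image.ι (pathEnd A) ≫ f :=
    kernel.lift_ι _ _ _
  rw [← cancel_mono (Abelian.image.ι (pathEnd B)), Category.assoc, Abelian.image.fac,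
    pathMap_pathEnd, Category.assoc (Abelian.factorThruImage (pathEnd A)), h,
    ← Category.assoc (Abelian.factorThruImage (pathEnd A)), Abelian.image.fac]

/-- Functoriality of `pathSeq`. -/
noncomputable def pathSeqMap : pathSeq A ⟶ pathSeq B where
  τ₁ := loopMap f
  τ₂ := pathMap f
  τ₃ := redMap f
  comm₁₂ := by simp [pathSeq, loopMap]
  comm₂₃ := pathMap_factorThruImage f

/-- Functoriality of `compSeq`. -/
noncomputable def compSeqMap : compSeq A ⟶ compSeq B where
  τ₁ := redMap f
  τ₂ := f
  τ₃ := compMap f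
  comm₁₂ := by simp [compSeq, redMap]
  comm₂₃ := by simp [compSeq, compMap]

lemma isZero_HH_pathObj (k : ℕ) (T : SSet.{u}) (A : SMod.{u}) :
    IsZero ((HH k T).obj (pathObj A)) := by
  let S : ShortComplex SMod.{u} := ShortComplex.mk (kernel.ι (decVertex A)) (decVertex A) (by simp)
  have hS : S.ShortExact :=
    { exact := ShortComplex.exact_of_f_is_kernel _ (kernelIsKernel _)
      mono_f := by dsimp [S]; infer_instance
      epi_g := by dsimp [S]; infer_instance }
  have hb (j : ℕ) : Function.Bijective ((HH j T).map S.g).hom :=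
    ConcreteCategory.bijective_of_isIso ((HH j T).map (decVertex A))
  rw [ModuleCat.isZero_iff_subsingleton] 
  refine ⟨fun x y => ?_⟩
  have key (x : (HH k T).obj S.X₁) : x = 0 := by
    have h1 : ((HH k T).map S.f).hom x = 0 := (hb k).1 (by
      rw [(HH_exact₂ k T hS).apply_apply_eq_zero, map_zero])
    obtain ⟨z, rfl⟩ := (HH_exact₁ k T hS x).1 h1
    obtain ⟨w, rfl⟩ := (hb (k + 1)).2 z
    exact (HH_exact₃ k T hS).apply_apply_eq_zero w
  rw [key x, key y]

/-- The inclusion of the constant simplicial vector space on the vertices. -/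
def degen (A : SMod.{u}) : constS.obj (A _⦋0⦌) ⟶ A where
  app n := A.map (SimplexCategory.isTerminalZero.from n.unop).op
  naturality m n g := by
    refine (Category.id_comp _).trans (Eq.trans ?_ (A.map_comp _ _))
    exact congrArg (fun g => A.map (Quiver.Hom.op g)) (SimplexCategory.isTerminalZero.hom_ext _ _)

lemma degen_naturality {A B : SMod.{u}} (f : A ⟶ B) :
    degen A ≫ f = constS.map (f.app _) ≫ degen B := by
  refine SimplicialObject.hom_ext _ _ fun n => ?_
  exact f.naturality _

lemma degen_app_zero (A : SMod.{u}) : (degen A).app (op ⦋0⦌) = 𝟙 _ := by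
  refine Eq.trans ?_ (A.map_id _)
  exact congrArg (fun g => A.map (Quiver.Hom.op g)) (SimplexCategory.isTerminalZero.hom_ext _ _)

/-- A map out of a constant simplicial vector space is determined by its vertices. -/
lemma hom_eq_degen {M : ModuleCat.{u} ℚ} {A : SMod.{u}} (g : constS.obj M ⟶ A) :
    g = constS.map (g.app (op ⦋0⦌)) ≫ degen A := by
  refine SimplicialObject.hom_ext _ _ fun n => ?_
  exact (Category.id_comp _).symm.trans
    (g.naturality (SimplexCategory.isTerminalZero.from n.unop).op)

instance (A : SMod.{u}) : Epi (decFace A) := by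
  have h (n : SimplexCategoryᵒᵖ) : Epi ((decFace A).app n) := by
    refine epi_of_epi_fac (f := A.map (SimplexCategory.σ (n := n.unop.len) 0).op) (h := 𝟙 _) ?_
    refine (A.map_comp _ _).symm.trans (Eq.trans ?_ (A.map_id _))
    refine congrArg (fun g => A.map (Quiver.Hom.op g)) (?_ : _ = 𝟙 n.unop)
    ext i : 3
    exact Fin.predAbove_zero_succ
  exact NatTrans.epi_of_epi_app _

instance (A : SMod.{u}) : IsIso (degen (compObj A)) := by
  let p : dec A ⟶ compObj A := decFace A ≫ cokernel.π (pathEnd A)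
  have hp : kernel.ι (decVertex A) ≫ p = 0 := by
    rw [← Category.assoc]
    exact cokernel.condition (pathEnd A)
  let g : constS.obj (A _⦋0⦌) ⟶ compObj A :=
    (Abelian.epiIsCokernelOfKernel _ (kernelIsKernel (decVertex A))).desc
      (CokernelCofork.ofπ p hp)
  have hg : decVertex A ≫ g = p :=
    (Abelian.epiIsCokernelOfKernel _ (kernelIsKernel (decVertex A))).fac
      (CokernelCofork.ofπ p hp) WalkingParallelPair.one
  have he : Epi g := epi_of_epi_fac hg
  have he' : Epi (degen (compObj A)) := by
    rw [hom_eq_degen g] at he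
    exact @epi_of_epi _ _ _ _ _ _ _ he
  rw [NatTrans.isIso_iff_isIso_app]
  intro n
  have h1 : Epi ((degen (compObj A)).app n) := inferInstance
  have h2 : Mono ((degen (compObj A)).app n) := by
    refine mono_of_mono_fac (f := (compObj A).map (SimplexCategory.const ⦋0⦌ n.unop 0).op)
      (h := 𝟙 _) ?_
    refine ((compObj A).map_comp _ _).symm.trans (Eq.trans ?_ ((compObj A).map_id _))
    exact congrArg (fun g => (compObj A).map (Quiver.Hom.op g))
      (SimplexCategory.isTerminalZero.hom_ext _ _)
  exact isIso_of_mono_of_epi _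

lemma surjective_app_zero_π (A : SMod.{u}) :
    Function.Surjective ((cokernel.π (pathEnd A)).app (op ⦋0⦌)).hom := by
  rw [← ModuleCat.epi_iff_surjective]
  infer_instance

lemma HH_compSeq_surjective (k : ℕ) (T : SSet.{u}) (A : SMod.{u}) :
    Function.Surjective ((HH k T).map (compSeq A).g).hom := by
  obtain ⟨s, hs⟩ := LinearMap.exists_rightInverse_of_surjective _
    (LinearMap.range_eq_top.2 (surjective_app_zero_π A))
  have h : (constS.map (ModuleCat.ofHom s) ≫ degen A) ≫ (compSeq A).g = degen (compObj A) := by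
    refine (Category.assoc _ _ _).trans ?_
    refine (congrArg (_ ≫ ·) (degen_naturality (cokernel.π (pathEnd A)))).trans ?_
    rw [← Category.assoc, ← Functor.map_comp]
    have : ModuleCat.ofHom s ≫ (cokernel.π (pathEnd A)).app (op ⦋0⦌) = 𝟙 _ :=
      ModuleCat.hom_ext hs
    rw [this, CategoryTheory.Functor.map_id, Category.id_comp]
  have h1 : Epi ((HH k T).map (degen (compObj A))) := inferInstance
  have h2 : Epi ((HH k T).map (compSeq A).g) :=
    @epi_of_epi_fac _ _ _ _ _ _ _ _ h1 (((HH k T).map_comp _ _).symm.trans (congrArg (HH k T).map h))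
  exact (ModuleCat.epi_iff_surjective _).1 h2

lemma HH_compSeq_injective (k : ℕ) (T : SSet.{u}) (A : SMod.{u}) :
    Function.Injective ((HH k T).map (compSeq A).f).hom := by
  rw [← LinearMap.ker_eq_bot, LinearMap.ker_eq_bot']
  intro x hx
  obtain ⟨z, rfl⟩ := (HH_exact₁ k T (compSeq_shortExact A) x).1 hx
  obtain ⟨w, rfl⟩ := HH_compSeq_surjective (k + 1) T A z
  exact (HH_exact₃ k T (compSeq_shortExact A)).apply_apply_eq_zero w

lemma HHδ_pathSeq_bijective (k : ℕ) (T : SSet.{u}) (A : SMod.{u}) :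
    Function.Bijective (HHδ k T (pathSeq_shortExact A)).hom := by
  have h (j : ℕ) : Subsingleton ((HH j T).obj (pathSeq A).X₂) :=
    ModuleCat.isZero_iff_subsingleton.1 (isZero_HH_pathObj j T A)
  constructor
  · rw [← LinearMap.ker_eq_bot, LinearMap.ker_eq_bot']
    intro x hx
    obtain ⟨z, rfl⟩ := (HH_exact₃ k T (pathSeq_shortExact A) x).1 hx
    rw [Subsingleton.elim z 0, map_zero]
  · intro x
    exact (HH_exact₁ k T (pathSeq_shortExact A) x).1 (Subsingleton.elim _ _)

lemma subsingleton_HH_zero_redObj (T : SSet.{u}) (A : SMod.{u}) :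
    Subsingleton ((HH 0 T).obj (redObj A)) := by
  have h : Subsingleton ((HH 0 T).obj (pathSeq A).X₂) :=
    ModuleCat.isZero_iff_subsingleton.1 (isZero_HH_pathObj 0 T A)
  exact (HH_zero_surjective T (pathSeq_shortExact A)).subsingleton

/-- The rational numbers as an object of `ModuleCat.{u} ℚ`. -/
noncomputable abbrev ratObj : ModuleCat.{u} ℚ := ModuleCat.of ℚ (ULift.{u} ℚ)

/-- Tensoring a constant simplicial vector space with a point does nothing. -/
noncomputable def tensorConstIso (pt : SSet.{u}) [∀ n, Unique (pt.obj n)] (V : ModuleCat.{u} ℚ) :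
    (tensor.obj pt).obj (constS.obj V) ≅ constS.obj V :=
  NatIso.ofComponents
    (fun n => (Finsupp.uniqueLinearEquiv ℚ V (default : pt.obj n)).toModuleIso)
    (fun {m n} θ => by
      refine tensor_hom_ext fun t a => ?_
      refine (congrArg (Finsupp.uniqueLinearEquiv ℚ V (default : pt.obj n))
        (tensor_map_single θ t a)).trans ?_
      obtain rfl := Subsingleton.elim default t
      have h : pt.map θ (default : pt.obj m) = default := Subsingleton.elim _ _
      refine Eq.trans ?_ (Eq.symm (Finsupp.single_eq_same (a := (default : pt.obj m)) (b := a)))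
      rw [h]
      exact Finsupp.single_eq_same)

/-- The homology of a constant simplicial vector space. -/
noncomputable def HHConstIso (k : ℕ) (pt : SSet.{u}) [∀ n, Unique (pt.obj n)]
    (V : ModuleCat.{u} ℚ) :
    (HH k pt).obj (constS.obj V) ≅ (ChainComplex.alternatingConst.obj V).homology k :=
  (HomologicalComplex.homologyFunctor _ _ k).mapIso
    ((alternatingFaceMapComplex _).mapIso (tensorConstIso pt V) ≪≫
      alternatingFaceMapComplexConst.app V)

lemma subsingleton_HH_const (k : ℕ) (pt : SSet.{u}) [∀ n, Unique (pt.obj n)]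
    (V : ModuleCat.{u} ℚ) : Subsingleton ((HH (k + 1) pt).obj (constS.obj V)) :=
  ModuleCat.isZero_iff_subsingleton.1 (IsZero.of_iso
    ((ChainComplex.alternatingConst_exactAt V (k + 1) (Nat.succ_ne_zero k)).isZero_homology)
    (HHConstIso (k + 1) pt V))

/-- The zeroth homology of a constant simplicial vector space. -/
noncomputable def HHConstZeroIso (pt : SSet.{u}) [∀ n, Unique (pt.obj n)] (V : ModuleCat.{u} ℚ) :
    (HH 0 pt).obj (constS.obj V) ≅ V :=
  HHConstIso 0 pt V ≪≫ ChainComplex.alternatingConstHomologyZero V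

lemma exists_surjective_of_additive (G : ModuleCat.{u} ℚ ⥤ ModuleCat.{u} ℚ) [G.Additive]
    (V : ModuleCat.{u} ℚ) [FiniteDimensional ℚ V] :
    ∃ (n : ℕ) (φ : (Fin n → G.obj ratObj.{u}) →ₗ[ℚ] G.obj V), Function.Surjective φ := by
  let b := Module.finBasis ℚ V
  let ι (i) : ratObj.{u} ⟶ V :=
    ModuleCat.ofHom ((LinearMap.toSpanSingleton ℚ V (b i)).comp ULift.moduleEquiv.toLinearMap)
  let π (i) : V ⟶ ratObj.{u} :=
    ModuleCat.ofHom (ULift.moduleEquiv.symm.toLinearMap.comp (b.coord i))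
  have h : ∑ i, π i ≫ ι i = 𝟙 V := by
    ext x
    simp [π, ι]
  refine ⟨_, ∑ i, (G.map (ι i)).hom.comp (LinearMap.proj i), fun y => ?_⟩
  refine ⟨fun i => (G.map (π i)).hom y, ?_⟩
  have h' := congrArg (fun g => (G.map g).hom y) h
  simpa [Functor.map_sum, ModuleCat.hom_sum] using h'

lemma subsingleton_of_additive (G : ModuleCat.{u} ℚ ⥤ ModuleCat.{u} ℚ) [G.Additive]
    (V : ModuleCat.{u} ℚ) [FiniteDimensional ℚ V] [Subsingleton (G.obj ratObj.{u})] :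
    Subsingleton (G.obj V) := by
  obtain ⟨n, φ, hφ⟩ := exists_surjective_of_additive G V
  exact hφ.subsingleton

lemma finiteDimensional_of_additive (G : ModuleCat.{u} ℚ ⥤ ModuleCat.{u} ℚ) [G.Additive]
    (V : ModuleCat.{u} ℚ) [FiniteDimensional ℚ V] [FiniteDimensional ℚ (G.obj ratObj.{u})] :
    FiniteDimensional ℚ (G.obj V) := by
  obtain ⟨n, φ, hφ⟩ := exists_surjective_of_additive G V
  exact Module.Finite.of_surjective φ hφ

/-- The homology of `compObj` is that of a constant simplicial vector space. -/
noncomputable def HHCompIso (k : ℕ) (T : SSet.{u}) (A : SMod.{u}) :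
    (HH k T).obj (constS.obj ((compObj A) _⦋0⦌)) ≅ (HH k T).obj (compObj A) :=
  (HH k T).mapIso (asIso (degen (compObj A)))

lemma subsingleton_of_exact {M N P : ModuleCat.{u} ℚ} {f : M ⟶ N} {g : N ⟶ P}
    (h : Function.Exact f.hom g.hom) (hM : Subsingleton M) (hP : Subsingleton P) :
    Subsingleton N := by
  have key (y : N) : y = 0 := by
    obtain ⟨x, rfl⟩ := (h y).1 (Subsingleton.elim _ _)
    rw [Subsingleton.elim x 0, map_zero]
  exact ⟨fun x y => (key x).trans (key y).symm⟩

lemma finiteDimensional_of_exact {M N P : ModuleCat.{u} ℚ} {f : M ⟶ N} {g : N ⟶ P}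
    (h : Function.Exact f.hom g.hom) (hM : FiniteDimensional ℚ M) (hP : FiniteDimensional ℚ P) :
    FiniteDimensional ℚ N :=
  have := isNoetherian_of_range_eq_ker f.hom g.hom h.linearMap_ker_eq.symm
  inferInstance

section

variable (pt : SSet.{u}) [∀ n, Unique (pt.obj n)] (T : SSet.{u})

lemma HH_compSeq_surjective_point (k : ℕ) (A : SMod.{u}) :
    Function.Surjective ((HH (k + 1) pt).map (compSeq A).f).hom := by
  have := subsingleton_HH_const k pt ((compObj A) _⦋0⦌)
  have : Subsingleton ((HH (k + 1) pt).obj (compSeq A).X₃) :=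
    (HHCompIso (k + 1) pt A).toLinearEquiv.symm.injective.subsingleton
  exact fun y => (HH_exact₂ (k + 1) pt (compSeq_shortExact A) y).1 (Subsingleton.elim _ _)

/-- The dimension shift from the loop object. -/
noncomputable def HHLoopEquiv (k : ℕ) (A : SMod.{u}) :
    (HH k pt).obj (loopObj A) ≃ₗ[ℚ] (HH (k + 1) pt).obj A :=
  (LinearEquiv.ofBijective _ (HHδ_pathSeq_bijective k pt A)).symm.trans
    (LinearEquiv.ofBijective _ ⟨HH_compSeq_injective (k + 1) pt A,
      HH_compSeq_surjective_point pt k A⟩)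

lemma finiteDimensional_comp (A : SMod.{u}) [FiniteDimensional ℚ ((HH 0 pt).obj A)] :
    FiniteDimensional ℚ ((compObj A) _⦋0⦌) := by
  have h1 : FiniteDimensional ℚ ((HH 0 pt).obj (compObj A)) := by
    have h0 : FiniteDimensional ℚ ((HH 0 pt).obj (compSeq A).X₂) :=
      ‹FiniteDimensional ℚ ((HH 0 pt).obj A)›
    exact Module.Finite.of_surjective _ (HH_compSeq_surjective 0 pt A)
  exact Module.Finite.equiv
    ((HHCompIso 0 pt A).symm ≪≫ HHConstZeroIso pt ((compObj A) _⦋0⦌)).toLinearEquiv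

lemma subsingleton_comp (A : SMod.{u}) [Subsingleton ((HH 0 pt).obj A)] :
    Subsingleton ((compObj A) _⦋0⦌) := by
  have h1 : Subsingleton ((HH 0 pt).obj (compObj A)) :=
    @Function.Surjective.subsingleton _ _ _ ‹Subsingleton ((HH 0 pt).obj A)›
      (HH_compSeq_surjective 0 pt A)
  exact ((HHCompIso 0 pt A).symm ≪≫
    HHConstZeroIso pt ((compObj A) _⦋0⦌)).toLinearEquiv.symm.injective.subsingleton

lemma subsingleton_HH_comp (k : ℕ) (A : SMod.{u})
    (h : Subsingleton ((HH k T).obj (constS.obj ratObj.{u})))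
    [FiniteDimensional ℚ ((HH 0 pt).obj A)] : Subsingleton ((HH k T).obj (compObj A)) := by
  have := finiteDimensional_comp pt A
  have : Subsingleton ((constS ⋙ HH k T).obj ratObj.{u}) := h
  have : Subsingleton ((HH k T).obj (constS.obj ((compObj A) _⦋0⦌))) :=
    subsingleton_of_additive (constS ⋙ HH k T) ((compObj A) _⦋0⦌)
  exact (HHCompIso k T A).toLinearEquiv.symm.injective.subsingleton

lemma finiteDimensional_HH_comp (k : ℕ) (A : SMod.{u})
    (h : FiniteDimensional ℚ ((HH k T).obj (constS.obj ratObj.{u})))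
    [FiniteDimensional ℚ ((HH 0 pt).obj A)] :
    FiniteDimensional ℚ ((HH k T).obj (compObj A)) := by
  have := finiteDimensional_comp pt A
  have : FiniteDimensional ℚ ((constS ⋙ HH k T).obj ratObj.{u}) := h
  have : FiniteDimensional ℚ ((HH k T).obj (constS.obj ((compObj A) _⦋0⦌))) :=
    finiteDimensional_of_additive (constS ⋙ HH k T) ((compObj A) _⦋0⦌)
  exact Module.Finite.equiv (HHCompIso k T A).toLinearEquiv

lemma subsingleton_HH_red (k : ℕ) (A : SMod.{u})
    (h : Subsingleton ((HH k T).obj (loopObj A))) :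
    Subsingleton ((HH (k + 1) T).obj (redObj A)) :=
  @Function.Injective.subsingleton _ _ _ (HHδ_pathSeq_bijective k T A).1 h

lemma finiteDimensional_HH_red (k : ℕ) (A : SMod.{u})
    (h : FiniteDimensional ℚ ((HH k T).obj (loopObj A))) :
    FiniteDimensional ℚ ((HH (k + 1) T).obj (redObj A)) :=
  @Module.Finite.equiv _ _ _ _ _ _ _ _ h
    (LinearEquiv.ofBijective _ (HHδ_pathSeq_bijective k T A)).symm

lemma subsingleton_HH_middle (k : ℕ) {S : ShortComplex SMod.{u}} (hS : S.ShortExact)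
    (h₁ : Subsingleton ((HH k T).obj S.X₁)) (h₂ : Subsingleton ((HH k T).obj S.X₃)) :
    Subsingleton ((HH k T).obj S.X₂) :=
  subsingleton_of_exact (HH_exact₂ k T hS) h₁ h₂

lemma finiteDimensional_HH_middle (k : ℕ) {S : ShortComplex SMod.{u}} (hS : S.ShortExact)
    (h₁ : FiniteDimensional ℚ ((HH k T).obj S.X₁))
    (h₂ : FiniteDimensional ℚ ((HH k T).obj S.X₃)) :
    FiniteDimensional ℚ ((HH k T).obj S.X₂) :=
  finiteDimensional_of_exact (HH_exact₂ k T hS) h₁ h₂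

lemma subsingleton_HH_of_red_of_comp (k : ℕ) (A : SMod.{u})
    (h₁ : Subsingleton ((HH k T).obj (redObj A))) (h₂ : Subsingleton ((HH k T).obj (compObj A))) :
    Subsingleton ((HH k T).obj A) :=
  subsingleton_HH_middle T k (S := compSeq A) (compSeq_shortExact A) h₁ h₂

lemma finiteDimensional_HH_of_red_of_comp (k : ℕ) (A : SMod.{u})
    (h₁ : FiniteDimensional ℚ ((HH k T).obj (redObj A)))
    (h₂ : FiniteDimensional ℚ ((HH k T).obj (compObj A))) :
    FiniteDimensional ℚ ((HH k T).obj A) :=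
  finiteDimensional_HH_middle T k (S := compSeq A) (compSeq_shortExact A) h₁ h₂

include pt in
lemma subsingleton_HH_comp_of_subsingleton (k : ℕ) (A : SMod.{u})
    (h : Subsingleton ((HH 0 pt).obj A)) : Subsingleton ((HH k T).obj (compObj A)) := by
  have := subsingleton_comp pt A
  have h0 : IsZero ((compObj A) _⦋0⦌) := ModuleCat.isZero_iff_subsingleton.2 this
  have h1 : IsZero ((constS ⋙ HH k T).obj ((compObj A) _⦋0⦌)) := Functor.map_isZero _ h0
  exact ModuleCat.isZero_iff_subsingleton.1 (h1.of_iso (HHCompIso k T A).symm)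

include pt in
/-- Tensoring an acyclic simplicial vector space gives an acyclic one. -/
lemma HH_subsingleton_of_acyclic (k : ℕ) (A : SMod.{u})
    (h : ∀ j, Subsingleton ((HH j pt).obj A)) : Subsingleton ((HH k T).obj A) := by
  have hc := subsingleton_HH_comp_of_subsingleton pt T k A (h 0)
  induction k generalizing A with
  | zero => exact subsingleton_HH_of_red_of_comp T 0 A (subsingleton_HH_zero_redObj T A) hc
  | succ k ih =>
    have hl (j : ℕ) : Subsingleton ((HH j pt).obj (loopObj A)) :=
      have := h (j + 1)
      (HHLoopEquiv pt j A).injective.subsingleton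
    exact subsingleton_HH_of_red_of_comp T (k + 1) A (subsingleton_HH_red T k A (ih _ hl
      (subsingleton_HH_comp_of_subsingleton pt T k _ (hl 0)))) hc

include pt in
lemma finiteDimensional_HH (k : ℕ) (A : SMod.{u})
    (hA : ∀ j, FiniteDimensional ℚ ((HH j pt).obj A))
    (hT : ∀ j, FiniteDimensional ℚ ((HH j T).obj (constS.obj ratObj.{u}))) :
    FiniteDimensional ℚ ((HH k T).obj A) := by
  induction k generalizing A with
  | zero =>
    have := hA 0
    have := subsingleton_HH_zero_redObj T A
    exact finiteDimensional_HH_of_red_of_comp T 0 A inferInstance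
      (finiteDimensional_HH_comp pt T 0 A (hT 0))
  | succ k ih =>
    have hl (j : ℕ) : FiniteDimensional ℚ ((HH j pt).obj (loopObj A)) :=
      have := hA (j + 1)
      Module.Finite.equiv (HHLoopEquiv pt j A).symm
    have := hA 0
    exact finiteDimensional_HH_of_red_of_comp T (k + 1) A
      (finiteDimensional_HH_red T k A (ih _ hl))
      (finiteDimensional_HH_comp pt T (k + 1) A (hT (k + 1)))

include pt in
lemma subsingleton_HH_of_bounded (N M k : ℕ) (A : SMod.{u})
    (hA : ∀ j, FiniteDimensional ℚ ((HH j pt).obj A))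
    (hN : ∀ j, N ≤ j → Subsingleton ((HH j pt).obj A))
    (hM : ∀ j, M ≤ j → Subsingleton ((HH j T).obj (constS.obj ratObj.{u})))
    (hk : N + M ≤ k) : Subsingleton ((HH k T).obj A) := by
  induction N generalizing k A with
  | zero => exact HH_subsingleton_of_acyclic pt T k A fun j => hN j (Nat.zero_le j)
  | succ N ih =>
    obtain ⟨k, rfl⟩ := Nat.exists_eq_succ_of_ne_zero (show k ≠ 0 by omega)
    have hl (j : ℕ) : FiniteDimensional ℚ ((HH j pt).obj (loopObj A)) :=
      have := hA (j + 1)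
      Module.Finite.equiv (HHLoopEquiv pt j A).symm
    have hlN (j : ℕ) (hj : N ≤ j) : Subsingleton ((HH j pt).obj (loopObj A)) :=
      have := hN (j + 1) (by omega)
      (HHLoopEquiv pt j A).injective.subsingleton
    have := hA 0
    exact subsingleton_HH_of_red_of_comp T (k + 1) A
      (subsingleton_HH_red T k A (ih k _ hl hlN (by omega)))
      (subsingleton_HH_comp pt T (k + 1) A (hM (k + 1) (by omega)))

end

/-- The class in degree zero homology of a chain in degree zero. -/
noncomputable def zeroClass (K : ChainComplex (ModuleCat.{u} ℚ) ℕ) : K.X 0 ⟶ K.homology 0 :=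
  have := K.isIso_iCycles 0 _ rfl (K.shape _ _ (by simp))
  inv (K.iCycles 0) ≫ K.homologyπ 0

lemma zeroClass_naturality {K L : ChainComplex (ModuleCat.{u} ℚ) ℕ} (f : K ⟶ L) :
    zeroClass K ≫ HomologicalComplex.homologyMap f 0 = f.f 0 ≫ zeroClass L := by
  have := K.isIso_iCycles 0 _ rfl (K.shape _ _ (by simp))
  have := L.isIso_iCycles 0 _ rfl (L.shape _ _ (by simp))
  simp [zeroClass, ← HomologicalComplex.cyclesMap_i_assoc]

lemma zeroClass_surjective (K : ChainComplex (ModuleCat.{u} ℚ) ℕ) :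
    Function.Surjective (zeroClass K).hom := by
  rw [← ModuleCat.epi_iff_surjective]
  have := K.isIso_iCycles 0 _ rfl (K.shape _ _ (by simp))
  unfold zeroClass
  infer_instance

/-- The map out of the constant simplicial vector space `ℚ` given by a vertex. -/
noncomputable def ofVertex {A : SMod.{u}} (x : A _⦋0⦌) : constS.obj ratObj.{u} ⟶ A :=
  constS.map (ModuleCat.ofHom
    ((LinearMap.toSpanSingleton ℚ _ x).comp ULift.moduleEquiv.toLinearMap)) ≫ degen A

lemma ofVertex_app_zero {A : SMod.{u}} (x : A _⦋0⦌) :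
    ((ofVertex x).app (op ⦋0⦌)).hom (ULift.up 1) = x := by
  have h : (ofVertex x).app (op ⦋0⦌) = ModuleCat.ofHom
      ((LinearMap.toSpanSingleton ℚ _ x).comp ULift.moduleEquiv.toLinearMap) :=
    (congrArg (_ ≫ ·) (degen_app_zero A)).trans (Category.comp_id _)
  rw [h]
  exact one_smul ℚ x

lemma ofVertex_comp {A B : SMod.{u}} (x : A _⦋0⦌) (f : A ⟶ B) :
    ofVertex x ≫ f = ofVertex ((f.app _).hom x) := by
  unfold ofVertex
  rw [Category.assoc, degen_naturality, ← Category.assoc, ← Functor.map_comp]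
  congr 2
  ext
  simp

lemma ofVertex_zero (A : SMod.{u}) : ofVertex (0 : A _⦋0⦌) = 0 := by
  have h : ModuleCat.ofHom ((LinearMap.toSpanSingleton ℚ _ (0 : A _⦋0⦌)).comp
      (ULift.moduleEquiv (R := ℚ) (M := ℚ)).toLinearMap) = 0 := by
    ext
    simp
  unfold ofVertex
  rw [h, Functor.map_zero, zero_comp]

lemma HH_ofVertex_injective (k : ℕ) (T : SSet.{u}) {A : SMod.{u}} [IsIso (degen A)]
    {x : A _⦋0⦌} (hx : x ≠ 0) : Function.Injective ((HH k T).map (ofVertex x)).hom := by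
  let g : ratObj.{u} ⟶ A _⦋0⦌ := ModuleCat.ofHom
    ((LinearMap.toSpanSingleton ℚ _ x).comp ULift.moduleEquiv.toLinearMap)
  obtain ⟨s, hs⟩ := LinearMap.exists_leftInverse_of_injective g.hom
    (LinearMap.ker_eq_bot.2 ((smul_left_injective ℚ hx).comp ULift.down_injective))
  have h : ofVertex x ≫ inv (degen A) ≫ constS.map (ModuleCat.ofHom s) = 𝟙 _ := by
    have h1 : g ≫ ModuleCat.ofHom s = 𝟙 _ := ModuleCat.hom_ext hs
    change (constS.map g ≫ degen A) ≫ _ = _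
    rw [Category.assoc, IsIso.hom_inv_id_assoc, ← Functor.map_comp, h1,
      CategoryTheory.Functor.map_id]
  have h2 := congrArg (HH k T).map h
  rw [Functor.map_comp, CategoryTheory.Functor.map_id] at h2
  exact (ModuleCat.mono_iff_injective _).1 (mono_of_mono_fac h2)

lemma HH_map_comp_apply (k : ℕ) (T : SSet.{u}) {A B C : SMod.{u}} (f : A ⟶ B) (g : B ⟶ C)
    (x : (HH k T).obj A) :
    ((HH k T).map (f ≫ g)).hom x = ((HH k T).map g).hom (((HH k T).map f).hom x) :=
  congrArg (fun g => g.hom x) ((HH k T).map_comp f g)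

lemma HHmap_naturality_apply (k : ℕ) {T T' : SSet.{u}} (ψ : T ⟶ T') {A B : SMod.{u}} (f : A ⟶ B)
    (x : (HH k T).obj A) :
    ((HHmap k ψ).app B).hom (((HH k T).map f).hom x) =
      ((HH k T').map f).hom (((HHmap k ψ).app A).hom x) :=
  congrArg (fun g => g.hom x) ((HHmap k ψ).naturality f)

/-- The map from the homology of the kernel of the projection to the components. -/
noncomputable def redIncl (k : ℕ) (T : SSet.{u}) (A : SMod.{u}) :
    (HH k T).obj (redObj A) →ₗ[ℚ] (HH k T).obj A :=
  ((HH k T).map (compSeq A).f).hom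

/-- The connecting homomorphism of the path fibration. -/
noncomputable def loopδ (k : ℕ) (T : SSet.{u}) (A : SMod.{u}) :
    (HH (k + 1) T).obj (redObj A) →ₗ[ℚ] (HH k T).obj (loopObj A) :=
  (HHδ k T (pathSeq_shortExact A)).hom

lemma redIncl_injective (k : ℕ) (T : SSet.{u}) (A : SMod.{u}) :
    Function.Injective (redIncl k T A) := HH_compSeq_injective k T A

lemma loopδ_bijective (k : ℕ) (T : SSet.{u}) (A : SMod.{u}) :
    Function.Bijective (loopδ k T A) := HHδ_pathSeq_bijective k T A

lemma redIncl_naturality (k : ℕ) (T : SSet.{u}) {A B : SMod.{u}} (f : A ⟶ B)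
    (c : (HH k T).obj (redObj A)) :
    redIncl k T B (((HH k T).map (redMap f)).hom c) = ((HH k T).map f).hom (redIncl k T A c) :=
  (HH_map_comp_apply k T (redMap f) (compSeq B).f c).symm.trans
    ((congrArg (fun g => ((HH k T).map g).hom c) (compSeqMap f).comm₁₂).trans
      (HH_map_comp_apply k T (compSeq A).f f c))

lemma redIncl_naturality_left (k : ℕ) {T T' : SSet.{u}} (ψ : T ⟶ T') (A : SMod.{u})
    (c : (HH k T).obj (redObj A)) :
    redIncl k T' A (((HHmap k ψ).app (redObj A)).hom c) =
      ((HHmap k ψ).app A).hom (redIncl k T A c) :=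
  (HHmap_naturality_apply k ψ (compSeq A).f c).symm

lemma loopδ_naturality (k : ℕ) (T : SSet.{u}) {A B : SMod.{u}} (f : A ⟶ B)
    (c : (HH (k + 1) T).obj (redObj A)) :
    loopδ k T B (((HH (k + 1) T).map (redMap f)).hom c) =
      ((HH k T).map (loopMap f)).hom (loopδ k T A c) :=
  (congrArg (fun g => g.hom c)
    (HHδ_naturality k T (pathSeq_shortExact A) (pathSeq_shortExact B) (pathSeqMap f))).symm

lemma loopδ_naturality_left (k : ℕ) {T T' : SSet.{u}} (ψ : T ⟶ T') (A : SMod.{u})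
    (c : (HH (k + 1) T).obj (redObj A)) :
    loopδ k T' A (((HHmap (k + 1) ψ).app (redObj A)).hom c) =
      ((HHmap k ψ).app (loopObj A)).hom (loopδ k T A c) :=
  (congrArg (fun g => g.hom c) (HHδ_naturality_left k T (pathSeq_shortExact A) ψ)).symm

section

variable (pt : SSet.{u}) [∀ n, Unique (pt.obj n)]

/-- The generator of the zeroth homology of the constant simplicial vector space `ℚ`. -/
noncomputable def generator : (HH 0 pt).obj (constS.obj ratObj.{u}) :=
  (zeroClass ((chains pt).obj (constS.obj ratObj.{u}))).hom
    (Finsupp.single (default : pt _⦋0⦌) (ULift.up 1))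

lemma exists_ofVertex {A : SMod.{u}} (a : (HH 0 pt).obj A) :
    ∃ x : A _⦋0⦌, ((HH 0 pt).map (ofVertex x)).hom (generator pt) = a := by
  obtain ⟨y, rfl⟩ := zeroClass_surjective _ a
  obtain ⟨x, rfl⟩ : ∃ x, y = Finsupp.single (default : pt _⦋0⦌) x :=
    ⟨_, ((Finsupp.uniqueLinearEquiv ℚ (A _⦋0⦌) (default : pt _⦋0⦌)).symm_apply_apply y).symm⟩
  refine ⟨x, ?_⟩
  have h := congrArg (fun g => g.hom (Finsupp.single (default : pt _⦋0⦌) (ULift.up 1)))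
    (zeroClass_naturality ((chains pt).map (ofVertex x)))
  refine h.trans (congrArg (zeroClass _).hom ?_)
  refine (tensor_map_app_single _ _ _).trans ?_
  rw [ofVertex_app_zero]

lemma exists_pathObj_of_π_eq_zero {B : SMod.{u}} (x : B _⦋0⦌)
    (hx : ((cokernel.π (pathEnd B)).app (op ⦋0⦌)).hom x = 0) :
    ∃ y : (pathObj B) _⦋0⦌, ((pathEnd B).app (op ⦋0⦌)).hom y = x := by
  let S : ShortComplex SMod.{u} := ShortComplex.mk (pathEnd B) (cokernel.π (pathEnd B)) (by simp)
  have hS : S.Exact := ShortComplex.exact_of_g_is_cokernel _ (cokernelIsCokernel _)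
  have h := hS.map ((evaluation _ _).obj (op ⦋0⦌))
  exact ((ShortComplex.ShortExact.moduleCat_exact_iff_function_exact _).1 h x).1 hx

lemma exists_cross_zero (T : SSet.{u}) (q : ℕ) {A : SMod.{u}} (a : (HH 0 pt).obj A) (ha : a ≠ 0)
    (b : (HH q T).obj (constS.obj ratObj.{u})) (hb : b ≠ 0) :
    ∃ c : (HH q T).obj A, c ≠ 0 ∧
      (∀ {T' : SSet.{u}} (ψ : T ⟶ T'), ((HHmap q ψ).app (constS.obj ratObj)).hom b = 0 →
        ((HHmap q ψ).app A).hom c = 0) ∧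
      ∀ {B : SMod.{u}} (f : A ⟶ B), ((HH 0 pt).map f).hom a = 0 → ((HH q T).map f).hom c = 0 := by
  obtain ⟨x, rfl⟩ := exists_ofVertex pt a
  refine ⟨((HH q T).map (ofVertex x)).hom b, ?_, ?_, ?_⟩
  · have hx : ((cokernel.π (pathEnd A)).app (op ⦋0⦌)).hom x ≠ 0 := by
      intro h
      have h1 : ((HH 0 pt).map (ofVertex x ≫ cokernel.π (pathEnd A))).hom (generator pt) = 0 := by
        rw [ofVertex_comp, h, ofVertex_zero, Functor.map_zero]
        rfl
      rw [Functor.map_comp] at h1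
      obtain ⟨z, hz⟩ : ∃ z, redIncl 0 pt A z = ((HH 0 pt).map (ofVertex x)).hom (generator pt) :=
        (HH_exact₂ 0 pt (compSeq_shortExact A) _).1 h1
      have := subsingleton_HH_zero_redObj pt A
      apply ha
      rw [← hz, Subsingleton.elim z 0, map_zero]
    have h1 := HH_ofVertex_injective q T hx
    rw [← ofVertex_comp, Functor.map_comp] at h1
    intro h0
    exact hb (h1 ((congrArg ((HH q T).map (cokernel.π (pathEnd A))).hom h0).trans
      ((map_zero _).trans (map_zero _).symm)))
  · intro T' ψ hψ
    have h := congrArg (fun g => g.hom b) ((HHmap q ψ).naturality (ofVertex x))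
    exact h.trans ((congrArg ((HH q T').map (ofVertex x)).hom hψ).trans (map_zero _))
  · intro B f hf
    have hf' : ((HH 0 pt).map (ofVertex ((f.app _).hom x))).hom (generator pt) = 0 := by
      rw [← ofVertex_comp, Functor.map_comp]
      exact hf
    have hx : ((cokernel.π (pathEnd B)).app (op ⦋0⦌)).hom ((f.app _).hom x) = 0 := by
      by_contra hx
      have h1 := HH_ofVertex_injective 0 pt hx
      have h2 : generator pt = 0 := by
        apply h1
        rw [← ofVertex_comp, Functor.map_comp]
        exact (congrArg ((HH 0 pt).map (cokernel.π (pathEnd B))).hom hf').trans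
          ((map_zero _).trans (map_zero _).symm)
      exact ha ((congrArg ((HH 0 pt).map (ofVertex x)).hom h2).trans (map_zero _))
    obtain ⟨y, hy⟩ := exists_pathObj_of_π_eq_zero _ hx
    have h3 : ofVertex x ≫ f = ofVertex y ≫ pathEnd B := by
      rw [ofVertex_comp, ofVertex_comp, hy]
    have := ModuleCat.isZero_iff_subsingleton.1 (isZero_HH_pathObj q T B)
    rw [← HH_map_comp_apply, h3, HH_map_comp_apply,
      Subsingleton.elim (((HH q T).map (ofVertex y)).hom b) 0, map_zero]

lemma HHLoopEquiv_loopδ (k : ℕ) {A : SMod.{u}} (c : (HH (k + 1) pt).obj (redObj A)) :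
    HHLoopEquiv pt k A (loopδ k pt A c) = redIncl (k + 1) pt A c :=
  congrArg (redIncl (k + 1) pt A)
    ((LinearEquiv.ofBijective _ (HHδ_pathSeq_bijective k pt A)).symm_apply_apply c)

lemma HHLoopEquiv_naturality (k : ℕ) {A B : SMod.{u}} (f : A ⟶ B) (x : (HH k pt).obj (loopObj A)) :
    HHLoopEquiv pt k B (((HH k pt).map (loopMap f)).hom x) =
      ((HH (k + 1) pt).map f).hom (HHLoopEquiv pt k A x) := by
  obtain ⟨c, rfl⟩ := (loopδ_bijective k pt A).2 x
  rw [← loopδ_naturality, HHLoopEquiv_loopδ, HHLoopEquiv_loopδ, redIncl_naturality]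

/-- Cross products of homology classes. -/
lemma exists_cross (T : SSet.{u}) (p q : ℕ) {A : SMod.{u}} (a : (HH p pt).obj A) (ha : a ≠ 0)
    (b : (HH q T).obj (constS.obj ratObj.{u})) (hb : b ≠ 0) :
    ∃ c : (HH (q + p) T).obj A, c ≠ 0 ∧
      (∀ {T' : SSet.{u}} (ψ : T ⟶ T'), ((HHmap q ψ).app (constS.obj ratObj)).hom b = 0 →
        ((HHmap (q + p) ψ).app A).hom c = 0) ∧
      ∀ {B : SMod.{u}} (f : A ⟶ B), ((HH p pt).map f).hom a = 0 →
        ((HH (q + p) T).map f).hom c = 0 := by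
  induction p generalizing A with
  | zero => exact exists_cross_zero pt T q a ha b hb
  | succ p ih =>
    obtain ⟨c', hc', h1, h2⟩ := ih ((HHLoopEquiv pt p A).symm a)
      (by simpa using ha)
    obtain ⟨c, rfl⟩ := (loopδ_bijective (q + p) T A).2 c'
    refine ⟨redIncl (q + p + 1) T A c, fun h0 => hc' ?_, fun {T'} ψ hψ => ?_, fun {B} f hf => ?_⟩
    · rw [redIncl_injective (q + p + 1) T A (h0.trans (map_zero _).symm), map_zero]
    · have h3 : ((HHmap (q + p + 1) ψ).app (redObj A)).hom c = 0 := by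
        apply (loopδ_bijective (q + p) T' A).1
        rw [map_zero, loopδ_naturality_left, h1 ψ hψ]
      exact (redIncl_naturality_left (q + p + 1) ψ A c).symm.trans
        ((congrArg (redIncl (q + p + 1) T' A) h3).trans (map_zero _))
    · have h3 := h2 (loopMap f) (by
        apply (HHLoopEquiv pt p B).injective
        rw [HHLoopEquiv_naturality, LinearEquiv.apply_symm_apply, hf, map_zero])
      have h4 : ((HH (q + p + 1) T).map (redMap f)).hom c = 0 := by
        apply (loopδ_bijective (q + p) T B).1
        rw [map_zero, loopδ_naturality, h3]
      exact (redIncl_naturality (q + p + 1) T f c).symm.trans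
        ((congrArg (redIncl (q + p + 1) T B) h4).trans (map_zero _))

end

/-- The basis vectors of `S →₀ ℚ`. -/
noncomputable def finsuppι {S : Type u} (s : S) :
    ratObj.{u} ⟶ (finsuppFunctor.obj S).obj ratObj := ModuleCat.ofHom (Finsupp.lsingle s)

/-- Coproducts of copies of `ℚ` as finitely supported functions. -/
noncomputable def sigmaConstIso (S : Type u) :
    (∐ fun _ : S => ratObj.{u}) ≅ (finsuppFunctor.obj S).obj ratObj where
  hom := Sigma.desc finsuppι
  inv := ModuleCat.ofHom (Finsupp.lsum ℚ fun s => (Sigma.ι (fun _ : S => ratObj.{u}) s).hom)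
  hom_inv_id := by
    refine Sigma.hom_ext _ _ fun s => ?_
    refine (Category.assoc _ _ _).symm.trans ?_
    refine (congrArg (· ≫ _) (Sigma.ι_desc finsuppι s)).trans ?_
    refine ModuleCat.hom_ext (LinearMap.ext fun x => ?_)
    exact Finsupp.sum_single_index (map_zero _)
  inv_hom_id := by
    refine ModuleCat.hom_ext (Finsupp.lhom_ext fun s x => ?_)
    have h := congrArg (fun g => g.hom x) (Sigma.ι_desc (finsuppι (S := S)) s)
    refine Eq.trans (congrArg (Limits.Sigma.desc finsuppι).hom ?_) h
    exact Finsupp.sum_single_index (map_zero _)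

lemma sigmaConstIso_naturality {S T : Type u} (f : S ⟶ T) :
    (sigmaConst.obj ratObj.{u}).map f ≫ (sigmaConstIso T).hom =
      (sigmaConstIso S).hom ≫ (finsuppFunctor.map f).app ratObj := by
  refine Sigma.hom_ext _ _ fun s => ?_
  have h1 : Sigma.ι (fun _ : S => ratObj.{u}) s ≫ (sigmaConst.obj ratObj.{u}).map f =
    Sigma.ι (fun _ : T => ratObj.{u}) (f s) := by
    refine (Sigma.ι_comp_map' _ _ _).trans (Category.id_comp _)
  have h2 : finsuppι s ≫ (finsuppFunctor.map f).app ratObj.{u} = finsuppι (f s) :=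
    ModuleCat.hom_ext (LinearMap.ext fun x => Finsupp.mapDomain_single)
  refine (Category.assoc _ _ _).symm.trans ((congrArg (· ≫ (sigmaConstIso T).hom) h1).trans ?_)
  refine Eq.trans (Sigma.ι_desc finsuppι (f s)) (Eq.trans h2.symm ?_)
  exact (congrArg (· ≫ (finsuppFunctor.map f).app ratObj) (Sigma.ι_desc finsuppι s)).symm.trans
    (Category.assoc _ _ _)

/-- The simplicial chains of a simplicial set. -/
noncomputable def freeIso (T : SSet.{u}) :
    T ⋙ sigmaConst.obj ratObj.{u} ≅ (tensor.obj T).obj (constS.obj ratObj) :=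
  NatIso.ofComponents (fun n => sigmaConstIso (T.obj n)) (fun {m n} θ => by
    refine (sigmaConstIso_naturality (T.map θ)).trans ?_
    refine congrArg ((sigmaConstIso (T.obj m)).hom ≫ ·) ?_
    refine (Category.comp_id _).symm.trans ?_
    exact congrArg ((finsuppFunctor.map (T.map θ)).app ratObj ≫ ·)
      ((finsuppFunctor.obj (T.obj n)).map_id ratObj).symm)

lemma freeIso_naturality {S T : SSet.{u}} (f : S ⟶ T) :
    Functor.whiskerRight f (sigmaConst.obj ratObj.{u}) ≫ (freeIso T).hom =
      (freeIso S).hom ≫ (tensor.map f).app (constS.obj ratObj) := by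
  refine SimplicialObject.hom_ext _ _ fun n => ?_
  refine (sigmaConstIso_naturality (f.app n)).trans ?_
  exact congrArg (_ ≫ ·) (tensor_map_app_app f (constS.obj ratObj) n).symm

/-- The singular simplicial set of a space. -/
noncomputable abbrev sing (X : Type u) [TopologicalSpace X] : SSet.{u} :=
  TopCat.toSSet.obj (TopCat.of X)

/-- The map of singular simplicial sets. -/
noncomputable abbrev singMap {X Y : Type u} [TopologicalSpace X] [TopologicalSpace Y]
    (f : C(X, Y)) : sing X ⟶ sing Y := TopCat.toSSet.map (TopCat.ofHom f)

section

variable {X Y : Type u} [TopologicalSpace X] [TopologicalSpace Y]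

/-- Singular homology as homology of `tensor`. -/
noncomputable def homologyEquiv (k : ℕ) (X : Type u) [TopologicalSpace X] :
    homology k X ≃ₗ[ℚ] (HH k (sing X)).obj (constS.obj ratObj) :=
  ((HomologicalComplex.homologyFunctor _ _ k).mapIso
    ((alternatingFaceMapComplex _).mapIso (freeIso (sing X)))).toLinearEquiv

lemma homologyEquiv_naturality (k : ℕ) (f : C(X, Y)) (x : homology k X) :
    homologyEquiv k Y (homologyMap k f x) =
      ((HHmap k (singMap f)).app (constS.obj ratObj)).hom (homologyEquiv k X x) := by
  let G : SMod.{u} ⥤ ModuleCat.{u} ℚ :=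
    alternatingFaceMapComplex _ ⋙ HomologicalComplex.homologyFunctor _ _ k
  have h := congrArg G.map (freeIso_naturality (singMap f))
  rw [Functor.map_comp, Functor.map_comp] at h
  exact congrArg (fun g => g.hom x) h

end

/-- The comparison map from functions on `Z` to functions on the product of `S` and `T`. -/
noncomputable def finsuppCross {Z S T : Type*} (s : Z → S) (t : Z → T) (M : Type*)
    [AddCommGroup M] [Module ℚ M] : (Z →₀ M) →ₗ[ℚ] T →₀ S →₀ M :=
  Finsupp.lsum ℚ fun z => (Finsupp.lsingle (t z)).comp (Finsupp.lsingle (s z))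

@[simp]
lemma finsuppCross_single {Z S T : Type*} (s : Z → S) (t : Z → T) {M : Type*}
    [AddCommGroup M] [Module ℚ M] (z : Z) (m : M) :
    finsuppCross s t M (Finsupp.single z m) = Finsupp.single (t z) (Finsupp.single (s z) m) := by
  simp [finsuppCross]

lemma finsuppCross_bijective {Z S T : Type*} {s : Z → S} {t : Z → T} (M : Type*)
    [AddCommGroup M] [Module ℚ M] (h : Function.Bijective fun z => (t z, s z)) :
    Function.Bijective (finsuppCross s t M) := by
  have e : finsuppCross s t M = ((Finsupp.domLCongr (Equiv.ofBijective _ h)).trans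
      (Finsupp.curryLinearEquiv ℚ)).toLinearMap := by
    refine Finsupp.lhom_ext fun z m => ?_
    simp
  rw [e]
  exact LinearEquiv.bijective _

/-- The comparison map from the chains of a simplicial set mapping to `S` and `T`. -/
noncomputable def crossMap {Z S T : SSet.{u}} (s : Z ⟶ S) (t : Z ⟶ T) (A : SMod.{u}) :
    (tensor.obj Z).obj A ⟶ (tensor.obj T).obj ((tensor.obj S).obj A) where
  app n := ModuleCat.ofHom (finsuppCross (s.app n) (t.app n) (A.obj n))
  naturality m n θ := by
    refine tensor_hom_ext fun z a => ?_
    refine (congrArg (finsuppCross (s.app n) (t.app n) (A.obj n)) (tensor_map_single θ z a)).trans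
      ((finsuppCross_single _ _ _ _).trans ?_)
    refine Eq.trans ?_ (congrArg (((tensor.obj T).obj ((tensor.obj S).obj A)).map θ).hom
      (finsuppCross_single (s.app m) (t.app m) z a)).symm
    refine Eq.trans ?_ (tensor_map_single (A := (tensor.obj S).obj A) θ _ _).symm
    refine congrArg₂ (fun a b => Finsupp.single a b)
      (congrArg (fun g => g z) (t.naturality θ))
      (Eq.trans ?_ (tensor_map_single θ _ _).symm)
    exact congrArg (fun y => Finsupp.single y _) (congrArg (fun g => g z) (s.naturality θ))

lemma crossMap_naturality {Z S T Z' S' T' : SSet.{u}} {s : Z ⟶ S} {t : Z ⟶ T} {s' : Z' ⟶ S'}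
    {t' : Z' ⟶ T'} {h : Z ⟶ Z'} {f : S ⟶ S'} {g : T ⟶ T'} (hs : s ≫ f = h ≫ s')
    (ht : t ≫ g = h ≫ t') (A : SMod.{u}) :
    (tensor.map h).app A ≫ crossMap s' t' A =
      crossMap s t A ≫ (tensor.map g).app _ ≫ (tensor.obj T').map ((tensor.map f).app A) := by
  refine SimplicialObject.hom_ext _ _ fun n => ?_
  refine tensor_hom_ext fun z a => ?_
  refine (congrArg (finsuppCross (s'.app n) (t'.app n) (A.obj n))
    (tensor_map_app_app_single h A z a)).trans ((finsuppCross_single _ _ _ _).trans ?_)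
  refine Eq.symm ((congrArg (((tensor.map g).app ((tensor.obj S).obj A) ≫
    (tensor.obj T').map ((tensor.map f).app A)).app n).hom
      (finsuppCross_single (s.app n) (t.app n) z a)).trans ?_)
  refine (congrArg (((tensor.obj T').map ((tensor.map f).app A)).app n).hom
    (tensor_map_app_app_single g ((tensor.obj S).obj A) _ _)).trans ?_
  refine (tensor_map_app_single ((tensor.map f).app A) _ _).trans ?_
  refine congrArg₂ (fun a b => Finsupp.single a b)
    (congrArg (fun g => g.app n z) ht)
    ((tensor_map_app_app_single f A _ _).trans ?_)
  exact congrArg (fun y => Finsupp.single y a) (congrArg (fun g => g.app n z) hs)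

lemma isIso_crossMap {Z S T : SSet.{u}} (s : Z ⟶ S) (t : Z ⟶ T) (A : SMod.{u})
    (h : ∀ n, Function.Bijective fun z => (t.app n z, s.app n z)) : IsIso (crossMap s t A) := by
  rw [NatTrans.isIso_iff_isIso_app]
  intro n
  rw [ConcreteCategory.isIso_iff_bijective]
  exact finsuppCross_bijective _ (h n)

section

variable {X Y X' Y' : Type u} [TopologicalSpace X] [TopologicalSpace Y]
  [TopologicalSpace X'] [TopologicalSpace Y']

/-- The simplicial vector space of singular chains. -/
noncomputable abbrev singChains (X : Type u) [TopologicalSpace X] : SMod.{u} :=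
  (tensor.obj (sing X)).obj (constS.obj ratObj)

/-- The map of simplicial vector spaces of singular chains. -/
noncomputable abbrev singChainsMap (f : C(X, Y)) : singChains X ⟶ singChains Y :=
  (tensor.map (singMap f)).app (constS.obj ratObj)

lemma sing_prod_bijective (X Y : Type u) [TopologicalSpace X] [TopologicalSpace Y]
    (n : SimplexCategoryᵒᵖ) :
    Function.Bijective fun z : (sing (X × Y)).obj n =>
      ((singMap (ContinuousMap.snd : C(X × Y, Y))).app n z,
        (singMap (ContinuousMap.fst : C(X × Y, X))).app n z) := by
  constructor
  · intro z w h
    have h1 := congrArg (fun p => p.1.down.hom) h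
    have h2 := congrArg (fun p => p.2.down.hom) h
    refine ULift.ext _ _ (TopCat.hom_ext (ContinuousMap.ext fun x => Prod.ext ?_ ?_))
    · exact DFunLike.congr_fun h2 x
    · exact DFunLike.congr_fun h1 x
  · rintro ⟨σ, τ⟩
    exact ⟨ULift.up (TopCat.ofHom (τ.down.hom.prodMk σ.down.hom)), rfl⟩

instance (X Y : Type u) [TopologicalSpace X] [TopologicalSpace Y] :
    IsIso (crossMap (singMap (ContinuousMap.fst : C(X × Y, X)))
      (singMap (ContinuousMap.snd : C(X × Y, Y))) (constS.obj ratObj.{u})) :=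
  isIso_crossMap _ _ _ (sing_prod_bijective X Y)

/-- The homology of simplicial vector spaces. -/
noncomputable abbrev simplicialHomology (k : ℕ) : SMod.{u} ⥤ ModuleCat.{u} ℚ :=
  alternatingFaceMapComplex _ ⋙ HomologicalComplex.homologyFunctor _ _ k

/-- The comparison of the chains on a product with the tensor product of chains. -/
noncomputable def crossEquiv (k : ℕ) (X Y : Type u) [TopologicalSpace X] [TopologicalSpace Y] :
    (HH k (sing (X × Y))).obj (constS.obj ratObj) ≃ₗ[ℚ] (HH k (sing Y)).obj (singChains X) :=
  ((simplicialHomology k).mapIso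
    (asIso (crossMap (singMap (ContinuousMap.fst : C(X × Y, X)))
      (singMap (ContinuousMap.snd : C(X × Y, Y))) (constS.obj ratObj.{u})))).toLinearEquiv

lemma crossEquiv_naturality (k : ℕ) (f : C(X, X')) (g : C(Y, Y'))
    (c : (HH k (sing (X × Y))).obj (constS.obj ratObj)) :
    crossEquiv k X' Y' (((HHmap k (singMap (f.prodMap g))).app (constS.obj ratObj)).hom c) =
      ((HH k (sing Y')).map (singChainsMap f)).hom
        (((HHmap k (singMap g)).app (singChains X)).hom (crossEquiv k X Y c)) := by
  have h := congrArg (simplicialHomology k).map (crossMap_naturality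
    (s := singMap (ContinuousMap.fst : C(X × Y, X)))
    (t := singMap (ContinuousMap.snd : C(X × Y, Y)))
    (s' := singMap (ContinuousMap.fst : C(X' × Y', X')))
    (t' := singMap (ContinuousMap.snd : C(X' × Y', Y')))
    (h := singMap (f.prodMap g)) (f := singMap f) (g := singMap g) rfl rfl (constS.obj ratObj))
  rw [Functor.map_comp, Functor.map_comp, Functor.map_comp] at h
  exact congrArg (fun g => g.hom c) h

/-- The homology of a product as the homology of a tensor product. -/
noncomputable def prodEquiv (k : ℕ) (X Y : Type u) [TopologicalSpace X] [TopologicalSpace Y] :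
    homology k (X × Y) ≃ₗ[ℚ] (HH k (sing Y)).obj (singChains X) :=
  (homologyEquiv k (X × Y)).trans (crossEquiv k X Y)

lemma prodEquiv_naturality (k : ℕ) (f : C(X, X')) (g : C(Y, Y')) (c : homology k (X × Y)) :
    prodEquiv k X' Y' (homologyMap k (f.prodMap g) c) =
      ((HH k (sing Y')).map (singChainsMap f)).hom
        (((HHmap k (singMap g)).app (singChains X)).hom (prodEquiv k X Y c)) :=
  (congrArg (crossEquiv k X' Y') (homologyEquiv_naturality k (f.prodMap g) c)).trans
    (crossEquiv_naturality k f g _)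

lemma homologyMap_comp (k : ℕ) {Z : Type u} [TopologicalSpace Z] (g : C(Y, Z)) (f : C(X, Y))
    (x : homology k X) : homologyMap k (g.comp f) x = homologyMap k g (homologyMap k f x) :=
  congrArg (fun g => g.hom x)
    ((((singularHomologyFunctor (ModuleCat.{u} ℚ) k).obj (ModuleCat.of ℚ (ULift.{u} ℚ)))).map_comp
      (TopCat.ofHom f) (TopCat.ofHom g))

lemma homologyMap_id (k : ℕ) (x : homology k X) : homologyMap k (ContinuousMap.id X) x = x :=
  congrArg (fun g => g.hom x)
    ((((singularHomologyFunctor (ModuleCat.{u} ℚ) k).obj (ModuleCat.of ℚ (ULift.{u} ℚ)))).map_id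
      (TopCat.of X))

/-- The homology of homeomorphic spaces. -/
noncomputable def homologyCongr (k : ℕ) (e : X ≃ₜ Y) : homology k X ≃ₗ[ℚ] homology k Y :=
  (((singularHomologyFunctor (ModuleCat.{u} ℚ) k).obj (ModuleCat.of ℚ (ULift.{u} ℚ))).mapIso
    (TopCat.isoOfHomeo (X := TopCat.of X) (Y := TopCat.of Y) e)).toLinearEquiv

lemma homologyCongr_apply (k : ℕ) (e : X ≃ₜ Y) (x : homology k X) :
    homologyCongr k e x = homologyMap k (e : C(X, Y)) x := rfl

noncomputable instance (n : SimplexCategoryᵒᵖ) : Unique ((sing PUnit.{u + 1}).obj n) where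
  default := ULift.up (TopCat.ofHom (ContinuousMap.const _ PUnit.unit))
  uniq _ := ULift.ext _ _ (TopCat.hom_ext (ContinuousMap.ext fun _ => rfl))

/-- The homology of a space as the homology of its singular chains. -/
noncomputable def pointEquiv (k : ℕ) (X : Type u) [TopologicalSpace X] :
    homology k X ≃ₗ[ℚ] (HH k (sing PUnit.{u + 1})).obj (singChains X) :=
  (homologyCongr k (Homeomorph.prodPUnit X).symm).trans (prodEquiv k X PUnit.{u + 1})

lemma pointEquiv_naturality (k : ℕ) (f : C(X, Y)) (x : homology k X) :
    pointEquiv k Y (homologyMap k f x) =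
      ((HH k (sing PUnit.{u + 1})).map (singChainsMap f)).hom (pointEquiv k X x) := by
  have h1 : ((Homeomorph.prodPUnit Y).symm : C(Y, Y × PUnit.{u + 1})).comp f =
      (f.prodMap (ContinuousMap.id PUnit.{u + 1})).comp
        ((Homeomorph.prodPUnit X).symm : C(X, X × PUnit.{u + 1})) := rfl
  have h2 (A : SMod.{u}) (y : (HH k (sing PUnit.{u + 1})).obj A) :
      ((HHmap k (singMap (ContinuousMap.id PUnit.{u + 1}))).app A).hom y = y := by
    have h3 : singMap (ContinuousMap.id PUnit.{u + 1}) = 𝟙 _ := TopCat.toSSet.map_id _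
    have h4 : (tensor.map (𝟙 (sing PUnit.{u + 1}))).app A = 𝟙 _ := by
      rw [CategoryTheory.Functor.map_id]
      rfl
    have h5 := congrArg (simplicialHomology k).map h4
    rw [(simplicialHomology k).map_id] at h5
    rw [h3]
    exact congrArg (fun g => g.hom y) h5
  unfold pointEquiv
  rw [LinearEquiv.trans_apply, LinearEquiv.trans_apply, homologyCongr_apply, homologyCongr_apply,
    ← homologyMap_comp, h1, homologyMap_comp, prodEquiv_naturality, h2]

lemma subsingleton_homology_point (k : ℕ) : Subsingleton (homology (k + 1) PUnit.{u + 1}) :=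
  ModuleCat.isZero_iff_subsingleton.1
    (isZero_singularHomologyFunctor_of_totallyDisconnectedSpace _ _ _ _ (Nat.succ_ne_zero k))

lemma exists_bound {V : ℕ → Type*} [∀ i, AddCommGroup (V i)] [∀ i, Module ℚ (V i)]
    (h : FiniteTotalDim V) : ∃ N, ∀ j, N ≤ j → Subsingleton (V j) := by
  obtain ⟨N, hN⟩ := h.2.bddAbove
  refine ⟨N + 1, fun j hj => not_nontrivial_iff_subsingleton.1 fun hn => ?_⟩
  have := hN hn
  omega

/-- A product of spaces of finite homology rank has finite homology rank. -/
theorem finiteHomologyRank_prod (hX : FiniteHomologyRank X) (hY : FiniteHomologyRank Y) :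
    FiniteHomologyRank (X × Y) := by
  obtain ⟨N, hN⟩ := exists_bound hX
  obtain ⟨M, hM⟩ := exists_bound hY
  have hX1 (j : ℕ) : FiniteDimensional ℚ ((HH j (sing PUnit.{u + 1})).obj (singChains X)) :=
    have := hX.1 j
    Module.Finite.equiv (pointEquiv j X)
  have hX2 (j : ℕ) (hj : N ≤ j) :
      Subsingleton ((HH j (sing PUnit.{u + 1})).obj (singChains X)) :=
    have := hN j hj
    (pointEquiv j X).symm.injective.subsingleton
  have hY1 (j : ℕ) : FiniteDimensional ℚ ((HH j (sing Y)).obj (constS.obj ratObj)) :=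
    have := hY.1 j
    Module.Finite.equiv (homologyEquiv j Y)
  have hY2 (j : ℕ) (hj : M ≤ j) : Subsingleton ((HH j (sing Y)).obj (constS.obj ratObj)) :=
    have := hM j hj
    (homologyEquiv j Y).symm.injective.subsingleton
  refine ⟨fun i => ?_, (Set.finite_Iio (N + M)).subset fun i hi => ?_⟩
  · have := finiteDimensional_HH (sing PUnit.{u + 1}) (sing Y) i (singChains X) hX1 hY1
    exact Module.Finite.equiv (prodEquiv i X Y).symm
  · by_contra h
    have := subsingleton_HH_of_bounded (sing PUnit.{u + 1}) (sing Y) N M i (singChains X) hX1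
      hX2 hY2 (not_lt.1 h)
    exact not_subsingleton_iff_nontrivial.2 hi (prodEquiv i X Y).injective.subsingleton

/-- Cross products of homology classes of positive degree. -/
theorem exists_cross_homology (p q : ℕ) (a : homology (p + 1) X) (ha : a ≠ 0)
    (b : homology (q + 1) Y) (hb : b ≠ 0) :
    ∃ c : homology (q + 1 + (p + 1)) (X × Y), c ≠ 0 ∧
      homologyMap _ (ContinuousMap.fst : C(X × Y, X)) c = 0 ∧
      homologyMap _ (ContinuousMap.snd : C(X × Y, Y)) c = 0 ∧
      ∀ {X' Y' : Type u} [TopologicalSpace X'] [TopologicalSpace Y'] (f : C(X, X')) (g : C(Y, Y')),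
        homologyMap _ f a = 0 → homologyMap _ (f.prodMap g) c = 0 := by
  obtain ⟨c, hc, h1, h2⟩ := exists_cross (sing PUnit.{u + 1}) (sing Y) (p + 1) (q + 1)
    (pointEquiv _ X a) (by simpa using ha) (homologyEquiv _ Y b) (by simpa using hb)
  have h3 {X' Y' : Type u} [TopologicalSpace X'] [TopologicalSpace Y'] (f : C(X, X'))
      (g : C(Y, Y')) (hf : homologyMap _ f a = 0) :
      homologyMap _ (f.prodMap g) ((prodEquiv _ X Y).symm c) = 0 := by
    apply (prodEquiv _ X' Y').injective
    rw [prodEquiv_naturality, LinearEquiv.apply_symm_apply, ← HHmap_naturality_apply,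
      h2 (singChainsMap f) (by rw [← pointEquiv_naturality, hf, map_zero]), map_zero, map_zero]
  refine ⟨(prodEquiv _ X Y).symm c, by simpa using hc, ?_, ?_, h3⟩
  · let t : C(Y, PUnit.{u + 1}) := ContinuousMap.const _ PUnit.unit
    have h4 : homologyMap _ ((ContinuousMap.id X).prodMap t) ((prodEquiv _ X Y).symm c) = 0 := by
      apply (prodEquiv _ X PUnit.{u + 1}).injective
      rw [prodEquiv_naturality, LinearEquiv.apply_symm_apply, h1 (singMap t), map_zero, map_zero]
      rw [← homologyEquiv_naturality]
      have := subsingleton_homology_point.{u} q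
      rw [Subsingleton.elim (homologyMap (q + 1) t b) 0, map_zero]
    have h5 : (ContinuousMap.fst : C(X × Y, X)) =
      (ContinuousMap.fst : C(X × PUnit.{u + 1}, X)).comp ((ContinuousMap.id X).prodMap t) := rfl
    rw [h5, homologyMap_comp, h4, map_zero]
  · let t : C(X, PUnit.{u + 1}) := ContinuousMap.const _ PUnit.unit
    have := subsingleton_homology_point.{u} p
    have h4 := h3 t (ContinuousMap.id Y) (Subsingleton.elim _ _)
    have h5 : (ContinuousMap.snd : C(X × Y, Y)) =
      (ContinuousMap.snd : C(PUnit.{u + 1} × Y, Y)).comp (t.prodMap (ContinuousMap.id Y)) := rfl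
    rw [h5, homologyMap_comp, h4, map_zero]

end

section

variable {X₁ X₂ Y₁ Y₂ : Type u} [TopologicalSpace X₁] [TopologicalSpace X₂]
  [TopologicalSpace Y₁] [TopologicalSpace Y₂]

/-- The homomorphism `π_{n+2}(X₁ × X₂) → π_{n+2}(X₁) × π_{n+2}(X₂)` given by the projections. -/
noncomputable def homotopyGroupProdHom (n : ℕ) (x₁ : X₁) (x₂ : X₂) :
    Additive (π_ (n + 2) (X₁ × X₂) (x₁, x₂)) →+
      Additive (π_ (n + 2) X₁ x₁) × Additive (π_ (n + 2) X₂ x₂) :=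
  AddMonoidHom.prod (homotopyGroupMap n (ContinuousMap.fst (α := X₁) (β := X₂)) (x₁, x₂))
    (homotopyGroupMap n (ContinuousMap.snd (α := X₁) (β := X₂)) (x₁, x₂))

lemma homotopyGroupProdHom_bijective (n : ℕ) (x₁ : X₁) (x₂ : X₂) :
    Function.Bijective (homotopyGroupProdHom n x₁ x₂) := by
  constructor
  · intro a b h
    induction a using Quotient.inductionOn with | _ p
    induction b using Quotient.inductionOn with | _ q
    have h1 : GenLoop.Homotopic _ _ := Quotient.exact (congrArg Prod.fst h)
    have h2 : GenLoop.Homotopic _ _ := Quotient.exact (congrArg Prod.snd h)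
    exact Quotient.sound ⟨ContinuousMap.HomotopyRel.prod h1.some h2.some⟩
  · rintro ⟨a, b⟩
    induction a using Quotient.inductionOn with | _ p
    induction b using Quotient.inductionOn with | _ q
    exact ⟨Quotient.mk _ ⟨p.1.prodMk q.1, fun y hy => Prod.ext (p.2 y hy) (q.2 y hy)⟩, rfl⟩

/-- The isomorphism `π_{n+2}(X₁ × X₂) ⊗ ℚ ≃ π_{n+2}(X₁) ⊗ ℚ × π_{n+2}(X₂) ⊗ ℚ`. -/
noncomputable def rationalHomotopyProdEquiv (n : ℕ) (x₁ : X₁) (x₂ : X₂) :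
    ℚ ⊗[ℤ] Additive (π_ (n + 2) (X₁ × X₂) (x₁, x₂)) ≃ₗ[ℚ]
      (ℚ ⊗[ℤ] Additive (π_ (n + 2) X₁ x₁)) × (ℚ ⊗[ℤ] Additive (π_ (n + 2) X₂ x₂)) :=
  (LinearEquiv.baseChange ℤ ℚ _ _ (AddEquiv.ofBijective _
    (homotopyGroupProdHom_bijective n x₁ x₂)).toIntLinearEquiv).trans
    (TensorProduct.prodRight ℤ ℚ ℚ _ _)

lemma rationalHomotopyProdEquiv_tmul (n : ℕ) (x₁ : X₁) (x₂ : X₂) (r : ℚ)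
    (a : Additive (π_ (n + 2) (X₁ × X₂) (x₁, x₂))) :
    rationalHomotopyProdEquiv n x₁ x₂ (r ⊗ₜ a) =
      (r ⊗ₜ (homotopyGroupProdHom n x₁ x₂ a).1, r ⊗ₜ (homotopyGroupProdHom n x₁ x₂ a).2) :=
  rfl

lemma homotopyGroupProdHom_prodMap (n : ℕ) (f₁ : C(X₁, Y₁)) (f₂ : C(X₂, Y₂)) (x₁ : X₁) (x₂ : X₂)
    (a : Additive (π_ (n + 2) (X₁ × X₂) (x₁, x₂))) :
    homotopyGroupProdHom n (f₁ x₁) (f₂ x₂) (homotopyGroupMap n (f₁.prodMap f₂) (x₁, x₂) a) =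
      (homotopyGroupMap n f₁ x₁ (homotopyGroupProdHom n x₁ x₂ a).1,
        homotopyGroupMap n f₂ x₂ (homotopyGroupProdHom n x₁ x₂ a).2) := by
  induction a using Quotient.inductionOn with | _ p
  rfl

lemma rationalHomotopyProdEquiv_prodMap (n : ℕ) (f₁ : C(X₁, Y₁)) (f₂ : C(X₂, Y₂))
    (x₁ : X₁) (x₂ : X₂) (a : ℚ ⊗[ℤ] Additive (π_ (n + 2) (X₁ × X₂) (x₁, x₂))) :
    rationalHomotopyProdEquiv n (f₁ x₁) (f₂ x₂)
        (rationalHomotopyMap n (f₁.prodMap f₂) (x₁, x₂) a) =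
      (rationalHomotopyMap n f₁ x₁).prodMap (rationalHomotopyMap n f₂ x₂)
        (rationalHomotopyProdEquiv n x₁ x₂ a) := by
  induction a using TensorProduct.induction_on with
  | zero =>
    refine (congrArg _ (map_zero _)).trans ((map_zero _).trans ?_)
    simp only [map_zero]
  | add a b ha hb =>
    refine (congrArg _ (map_add _ a b)).trans ((map_add _ _ _).trans ?_)
    rw [ha, hb, map_add, map_add]
  | tmul r a =>
    refine (rationalHomotopyProdEquiv_tmul n (f₁ x₁) (f₂ x₂) r
      (homotopyGroupMap n (f₁.prodMap f₂) (x₁, x₂) a)).trans ?_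
    rw [homotopyGroupProdHom_prodMap]
    rfl

/-- The product of two submodules, as a module. -/
def submoduleProdEquiv {V W : Type*} [AddCommGroup V] [AddCommGroup W] [Module ℚ V] [Module ℚ W]
    (p : Submodule ℚ V) (q : Submodule ℚ W) : p.prod q ≃ₗ[ℚ] p × q where
  toFun x := (⟨x.1.1, x.2.1⟩, ⟨x.1.2, x.2.2⟩)
  invFun x := ⟨(x.1.1, x.2.1), x.1.2, x.2.2⟩
  map_add' _ _ := rfl
  map_smul' _ _ := rfl

/-- The kernel of `π_{n+2}(f₁ × f₂) ⊗ ℚ` is the product of the kernels. -/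
noncomputable def kerRationalHomotopyEquiv (n : ℕ) (f₁ : C(X₁, Y₁)) (f₂ : C(X₂, Y₂))
    (x₁ : X₁) (x₂ : X₂) :
    LinearMap.ker (rationalHomotopyMap n (f₁.prodMap f₂) (x₁, x₂)) ≃ₗ[ℚ]
      LinearMap.ker (rationalHomotopyMap n f₁ x₁) × LinearMap.ker (rationalHomotopyMap n f₂ x₂) :=
  (LinearEquiv.ofSubmodules (rationalHomotopyProdEquiv n x₁ x₂) _
    ((LinearMap.ker (rationalHomotopyMap n f₁ x₁)).prod
      (LinearMap.ker (rationalHomotopyMap n f₂ x₂))) (by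
      rw [← LinearMap.ker_prodMap]
      ext b
      obtain ⟨a, rfl⟩ := (rationalHomotopyProdEquiv n x₁ x₂).surjective b
      rw [Submodule.mem_map_equiv, LinearEquiv.symm_apply_apply, LinearMap.mem_ker,
        LinearMap.mem_ker, ← rationalHomotopyProdEquiv_prodMap]
      exact (LinearEquiv.map_eq_zero_iff _).symm)).trans
    (submoduleProdEquiv _ _)

end

section

lemma FiniteTotalDim.prod {V W U : ℕ → Type*} [∀ i, AddCommGroup (V i)] [∀ i, Module ℚ (V i)]
    [∀ i, AddCommGroup (W i)] [∀ i, Module ℚ (W i)] [∀ i, AddCommGroup (U i)]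
    [∀ i, Module ℚ (U i)] (hV : FiniteTotalDim V) (hW : FiniteTotalDim W)
    (e : ∀ i, U i ≃ₗ[ℚ] V i × W i) : FiniteTotalDim U := by
  refine ⟨fun i => ?_, (hV.2.union hW.2).subset fun i hi => ?_⟩
  · have := hV.1 i
    have := hW.1 i
    exact Module.Finite.equiv (e i).symm
  · by_contra h
    simp only [Set.mem_union, Set.mem_ofPred_eq, not_or, not_nontrivial_iff_subsingleton] at h
    have := h.1
    have := h.2
    exact not_subsingleton_iff_nontrivial.2 hi (e i).injective.subsingleton

lemma FiniteTotalDim.submodule {V : ℕ → Type*} [∀ i, AddCommGroup (V i)] [∀ i, Module ℚ (V i)]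
    (hV : FiniteTotalDim V) (p : ∀ i, Submodule ℚ (V i)) : FiniteTotalDim fun i => p i := by
  refine ⟨fun i => ?_, hV.2.subset fun i hi => ?_⟩
  · have := hV.1 i
    infer_instance
  · obtain ⟨a, b, h⟩ := hi
    exact ⟨a, b, fun h' => h (Subtype.ext h')⟩

lemma eval_finsum_monomial (d : ℕ → ℕ) (N : ℕ) (h : ∀ n, N ≤ n → d n = 0) :
    (∑ᶠ n, Polynomial.monomial (n + 2) (d n)).eval 1 = ∑ n ∈ Finset.range N, d n := by
  rw [finsum_eq_sum_of_support_subset (s := Finset.range N), Polynomial.eval_finsetSum]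
  · simp
  · intro n hn
    by_contra hn'
    exact hn (by simp [h n (by simpa using hn')])

variable {X Y : Type u} [TopologicalSpace X] [TopologicalSpace Y]

lemma exists_eval_homologicalPoincare {f : C(X, Y)}
    (h : FiniteTotalDim fun i => LinearMap.ker (homologyMap i f)) :
    ∃ N, ∀ M, N ≤ M → (homologicalPoincare f).eval 1 =
      1 + ∑ n ∈ Finset.range M, Module.finrank ℚ (LinearMap.ker (homologyMap (n + 2) f)) := by
  obtain ⟨N, hN⟩ := exists_bound h
  refine ⟨N, fun M hM => ?_⟩
  rw [homologicalPoincare, Polynomial.eval_add, Polynomial.eval_one, eval_finsum_monomial _ M]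
  intro n hn
  have := hN (n + 2) (by omega)
  exact Module.finrank_zero_of_subsingleton

lemma exists_eval_homotopicalPoincare {f : C(X, Y)} {x : X}
    (h : FiniteTotalDim fun n => LinearMap.ker (rationalHomotopyMap n f x)) :
    ∃ N, ∀ M, N ≤ M → (homotopicalPoincare f x).eval 1 =
      ∑ n ∈ Finset.range M, Module.finrank ℚ (LinearMap.ker (rationalHomotopyMap n f x)) := by
  obtain ⟨N, hN⟩ := exists_bound h
  refine ⟨N, fun M hM => ?_⟩
  rw [homotopicalPoincare, eval_finsum_monomial _ M]
  intro n hn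
  have := hN n (by omega)
  exact Module.finrank_zero_of_subsingleton

lemma homologyMap_const (k : ℕ) (y : Y) (a : homology (k + 1) X) :
    homologyMap (k + 1) (ContinuousMap.const X y) a = 0 := by
  have := subsingleton_homology_point.{u} k
  have h : ContinuousMap.const X y =
    (ContinuousMap.const PUnit.{u + 1} y).comp (ContinuousMap.const X PUnit.unit) := rfl
  rw [h, homologyMap_comp, Subsingleton.elim (homologyMap (k + 1) _ a) 0, map_zero]

variable {X₁ X₂ Y₁ Y₂ : Type u} [TopologicalSpace X₁] [TopologicalSpace X₂]
  [TopologicalSpace Y₁] [TopologicalSpace Y₂]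

/-- The map `Ker H_k(f₁ × f₂) → H_k(X₁) × H_k(X₂)` given by the projections. -/
noncomputable def kerProj (k : ℕ) (f₁ : C(X₁, Y₁)) (f₂ : C(X₂, Y₂)) :
    LinearMap.ker (homologyMap k (f₁.prodMap f₂)) →ₗ[ℚ] homology k X₁ × homology k X₂ :=
  ((homologyMap k (ContinuousMap.fst : C(X₁ × X₂, X₁))).prod
    (homologyMap k (ContinuousMap.snd : C(X₁ × X₂, X₂)))).comp (Submodule.subtype _)

lemma ker_prod_ker_le_range_kerProj (k : ℕ) (f₁ : C(X₁, Y₁)) (f₂ : C(X₂, Y₂)) (x₁ : X₁)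
    (x₂ : X₂) : (LinearMap.ker (homologyMap (k + 1) f₁)).prod
      (LinearMap.ker (homologyMap (k + 1) f₂)) ≤ LinearMap.range (kerProj (k + 1) f₁ f₂) := by
  rintro ⟨a, b⟩ ⟨ha, hb⟩
  let i₁ : C(X₁, X₁ × X₂) := (ContinuousMap.id X₁).prodMk (ContinuousMap.const X₁ x₂)
  let i₂ : C(X₂, X₁ × X₂) := (ContinuousMap.const X₂ x₁).prodMk (ContinuousMap.id X₂)
  have ha' : homologyMap (k + 1) (f₁.prodMap f₂) (homologyMap (k + 1) i₁ a) = 0 := by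
    have h : (f₁.prodMap f₂).comp i₁ =
      ((ContinuousMap.id Y₁).prodMk (ContinuousMap.const Y₁ (f₂ x₂))).comp f₁ := rfl
    rw [← homologyMap_comp, h, homologyMap_comp, LinearMap.mem_ker.1 ha, map_zero]
  have hb' : homologyMap (k + 1) (f₁.prodMap f₂) (homologyMap (k + 1) i₂ b) = 0 := by
    have h : (f₁.prodMap f₂).comp i₂ =
      ((ContinuousMap.const Y₂ (f₁ x₁)).prodMk (ContinuousMap.id Y₂)).comp f₂ := rfl
    rw [← homologyMap_comp, h, homologyMap_comp, LinearMap.mem_ker.1 hb, map_zero]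
  have h11 : homologyMap (k + 1) (ContinuousMap.fst : C(X₁ × X₂, X₁)) (homologyMap _ i₁ a) = a :=
    (homologyMap_comp _ _ _ _).symm.trans (homologyMap_id _ a)
  have h21 : homologyMap (k + 1) (ContinuousMap.snd : C(X₁ × X₂, X₂)) (homologyMap _ i₁ a) = 0 :=
    (homologyMap_comp _ _ _ _).symm.trans (homologyMap_const k x₂ a)
  have h12 : homologyMap (k + 1) (ContinuousMap.fst : C(X₁ × X₂, X₁)) (homologyMap _ i₂ b) = 0 :=
    (homologyMap_comp _ _ _ _).symm.trans (homologyMap_const k x₁ b)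
  have h22 : homologyMap (k + 1) (ContinuousMap.snd : C(X₁ × X₂, X₂)) (homologyMap _ i₂ b) = b :=
    (homologyMap_comp _ _ _ _).symm.trans (homologyMap_id _ b)
  refine ⟨⟨homologyMap _ i₁ a + homologyMap _ i₂ b, ?_⟩, Prod.ext ?_ ?_⟩
  · rw [LinearMap.mem_ker, map_add, ha', hb', add_zero]
  · exact (map_add _ _ _).trans (by rw [h11, h12, add_zero])
  · exact (map_add _ _ _).trans (by rw [h21, h22, zero_add])

lemma finrank_ker_add_le (k : ℕ) (f₁ : C(X₁, Y₁)) (f₂ : C(X₂, Y₂)) (x₁ : X₁) (x₂ : X₂)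
    (h₁ : FiniteHomologyRank X₁) (h₂ : FiniteHomologyRank X₂) :
    Module.finrank ℚ (LinearMap.ker (homologyMap (k + 1) f₁)) +
        Module.finrank ℚ (LinearMap.ker (homologyMap (k + 1) f₂)) +
        Module.finrank ℚ (LinearMap.ker (kerProj (k + 1) f₁ f₂)) ≤
      Module.finrank ℚ (LinearMap.ker (homologyMap (k + 1) (f₁.prodMap f₂))) := by
  have := h₁.1 (k + 1)
  have := h₂.1 (k + 1)
  have := (finiteHomologyRank_prod h₁ h₂).1 (k + 1)
  have h := Submodule.finrank_mono (ker_prod_ker_le_range_kerProj k f₁ f₂ x₁ x₂)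
  rw [(submoduleProdEquiv _ _).finrank_eq, Module.finrank_prod] at h
  rw [← (kerProj (k + 1) f₁ f₂).finrank_range_add_finrank_ker]
  omega

lemma exists_finrank_ker_kerProj_pos (p q : ℕ) (f₁ : C(X₁, Y₁)) (f₂ : C(X₂, Y₂))
    (h₁ : FiniteHomologyRank X₁) (h₂ : FiniteHomologyRank X₂)
    (hp : Module.finrank ℚ (LinearMap.ker (homologyMap (p + 2) f₁)) ≠ 0)
    (hq : Module.finrank ℚ (LinearMap.ker (homologyMap (q + 2) f₂)) ≠ 0) :
    ∃ n, 0 < Module.finrank ℚ (LinearMap.ker (kerProj (n + 2) f₁ f₂)) := by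
  have := Module.nontrivial_of_finrank_pos (Nat.pos_of_ne_zero hp)
  have := Module.nontrivial_of_finrank_pos (Nat.pos_of_ne_zero hq)
  obtain ⟨⟨a, ha⟩, ha0⟩ := exists_ne (0 : LinearMap.ker (homologyMap (p + 2) f₁))
  obtain ⟨⟨b, hb⟩, hb0⟩ := exists_ne (0 : LinearMap.ker (homologyMap (q + 2) f₂))
  obtain ⟨c, hc, hc1, hc2, hc3⟩ := exists_cross_homology (p + 1) (q + 1) a
    (fun h => ha0 (Subtype.ext h)) b (fun h => hb0 (Subtype.ext h))
  refine ⟨q + 2 + p, ?_⟩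
  have := (finiteHomologyRank_prod h₁ h₂).1 (q + 2 + p + 2)
  refine Module.finrank_pos_iff_exists_ne_zero.2
    ⟨⟨⟨c, hc3 f₁ f₂ ha⟩, Prod.ext hc1 hc2⟩, fun h => hc ?_⟩
  exact congrArg (fun z => z.1.1) h

end

end RatMap

theorem mainTheorem6 {X₁ X₂ Y₁ Y₂ : Type u}
    [TopologicalSpace X₁] [TopologicalSpace X₂] [TopologicalSpace Y₁] [TopologicalSpace Y₂]
    [SimplyConnectedSpace X₁] [SimplyConnectedSpace X₂]
    [SimplyConnectedSpace Y₁] [SimplyConnectedSpace Y₂]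
    (f₁ : C(X₁, Y₁)) (f₂ : C(X₂, Y₂)) (x₁ : X₁) (x₂ : X₂)
    (hX₁ : RatMap.FiniteHomologyRank X₁) (hX₂ : RatMap.FiniteHomologyRank X₂)
    (hf₁ : RatMap.IsRationallyEllipticKer f₁ x₁) (hf₂ : RatMap.IsRationallyEllipticKer f₂ x₂)
    (h₁ : (RatMap.homotopicalPoincare f₁ x₁).eval 1 ≤ (RatMap.homologicalPoincare f₁).eval 1)
    (h₂ : (RatMap.homotopicalPoincare f₂ x₂).eval 1 ≤ (RatMap.homologicalPoincare f₂).eval 1)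
    (hcases :
      (2 ≤ (RatMap.homologicalPoincare f₁).eval 1 ∧ 2 ≤ (RatMap.homologicalPoincare f₂).eval 1) ∨
      ((RatMap.homotopicalPoincare f₁ x₁).eval 1 = 0 ∨
        (RatMap.homotopicalPoincare f₂ x₂).eval 1 = 0)) :
    RatMap.IsRationallyEllipticKer (f₁.prodMap f₂) (x₁, x₂) ∧
      (RatMap.homotopicalPoincare (f₁.prodMap f₂) (x₁, x₂)).eval 1 ≤
        (RatMap.homologicalPoincare (f₁.prodMap f₂)).eval 1 := by
  have hell : RatMap.IsRationallyEllipticKer (f₁.prodMap f₂) (x₁, x₂) :=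
    ⟨(RatMap.finiteHomologyRank_prod hX₁ hX₂).submodule _,
      hf₁.homotopy.prod hf₂.homotopy fun n => RatMap.kerRationalHomotopyEquiv n f₁ f₂ x₁ x₂⟩
  refine ⟨hell, ?_⟩
  obtain ⟨A₁, hA₁⟩ := RatMap.exists_eval_homotopicalPoincare hf₁.homotopy
  obtain ⟨A₂, hA₂⟩ := RatMap.exists_eval_homotopicalPoincare hf₂.homotopy
  obtain ⟨A, hA⟩ := RatMap.exists_eval_homotopicalPoincare hell.homotopy
  obtain ⟨B₁, hB₁⟩ := RatMap.exists_eval_homologicalPoincare hf₁.homology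
  obtain ⟨B₂, hB₂⟩ := RatMap.exists_eval_homologicalPoincare hf₂.homology
  obtain ⟨B, hB⟩ := RatMap.exists_eval_homologicalPoincare hell.homology
  have hπ : (RatMap.homotopicalPoincare (f₁.prodMap f₂) (x₁, x₂)).eval 1 =
      (RatMap.homotopicalPoincare f₁ x₁).eval 1 + (RatMap.homotopicalPoincare f₂ x₂).eval 1 := by
    rw [hA (A + A₁ + A₂) (by omega), hA₁ (A + A₁ + A₂) (by omega), hA₂ (A + A₁ + A₂) (by omega),
      ← Finset.sum_add_distrib]
    refine Finset.sum_congr rfl fun n _ => ?_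
    have := hf₁.homotopy.1 n
    have := hf₂.homotopy.1 n
    rw [(RatMap.kerRationalHomotopyEquiv n f₁ f₂ x₁ x₂).finrank_eq, Module.finrank_prod]
  have key (M : ℕ) (hM : B + B₁ + B₂ ≤ M) :
      (RatMap.homologicalPoincare f₁).eval 1 + (RatMap.homologicalPoincare f₂).eval 1 +
        ∑ n ∈ Finset.range M, Module.finrank ℚ (LinearMap.ker (RatMap.kerProj (n + 2) f₁ f₂)) ≤
      (RatMap.homologicalPoincare (f₁.prodMap f₂)).eval 1 + 1 := by
    have h : ∑ n ∈ Finset.range M,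
        (Module.finrank ℚ (LinearMap.ker (RatMap.homologyMap (n + 2) f₁)) +
          Module.finrank ℚ (LinearMap.ker (RatMap.homologyMap (n + 2) f₂)) +
          Module.finrank ℚ (LinearMap.ker (RatMap.kerProj (n + 2) f₁ f₂))) ≤
        ∑ n ∈ Finset.range M,
          Module.finrank ℚ (LinearMap.ker (RatMap.homologyMap (n + 2) (f₁.prodMap f₂))) :=
      Finset.sum_le_sum fun n _ => RatMap.finrank_ker_add_le (n + 1) f₁ f₂ x₁ x₂ hX₁ hX₂
    rw [Finset.sum_add_distrib, Finset.sum_add_distrib] at h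
    have e := hB M (by omega)
    have e₁ := hB₁ M (by omega)
    have e₂ := hB₂ M (by omega)
    omega
  have hpos (M : ℕ) (hM : B + B₁ + B₂ ≤ M) : 1 ≤ (RatMap.homologicalPoincare f₁).eval 1 ∧
      1 ≤ (RatMap.homologicalPoincare f₂).eval 1 := by
    rw [hB₁ M (by omega), hB₂ M (by omega)]
    omega
  rcases hcases with ⟨h2₁, h2₂⟩ | h0
  · have e₁ := hB₁ B₁ le_rfl
    have e₂ := hB₂ B₂ le_rfl
    obtain ⟨p, -, hp⟩ := Finset.exists_ne_zero_of_sum_ne_zero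
      (show ∑ n ∈ Finset.range B₁, Module.finrank ℚ
        (LinearMap.ker (RatMap.homologyMap (n + 2) f₁)) ≠ 0 by omega)
    obtain ⟨q, -, hq⟩ := Finset.exists_ne_zero_of_sum_ne_zero
      (show ∑ n ∈ Finset.range B₂, Module.finrank ℚ
        (LinearMap.ker (RatMap.homologyMap (n + 2) f₂)) ≠ 0 by omega)
    obtain ⟨n, hn⟩ := RatMap.exists_finrank_ker_kerProj_pos p q f₁ f₂ hX₁ hX₂ hp hq
    have h := key (B + B₁ + B₂ + n + 1) (by omega)
    have h' := Finset.single_le_sum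
      (f := fun n => Module.finrank ℚ (LinearMap.ker (RatMap.kerProj (n + 2) f₁ f₂)))
      (fun _ _ => Nat.zero_le _) (Finset.mem_range.2 (show n < B + B₁ + B₂ + n + 1 by omega))
    have h'' := hn.trans_le h'
    omega
  · have h := key _ le_rfl
    have h' := hpos _ le_rfl
    omega
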